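/- Let $\mathbb{K}$ be an algebraically closed field of characteristic $0$, and let $p\in\mathbb{K}[x,y]\setminus(\mathbb{K}[x]\cup\mathbb{K}[y])$ be irreducible. Let $\mathbb{K}[x,y]_p$ be the ring of rational functions in $\mathbb{K}(x,y)$ whose reduced denominator is not divisible by $p$, and $\langle p\rangle$ the ideal of it generated by $p$. Let $r\in\mathbb{K}[x,y]_p\setminus\langle p\rangle$, and let $f\in\mathbb{K}(x)$, $g\in\mathbb{K}(y)$ be such that $f-g\in r+\langle p\rangle$. Let $C\subseteq\mathbb{P}^1(\mathbb{K})\times\mathbb{P}^1(\mathbb{K})$, where $\mathbb{P}^1(\mathbb{K})=\mathbb{K}\cup\{\infty\}$, be the curve defined by the bi-homogenization $x_0^{\deg_x p}y_0^{\deg_y p}p(x_1/x_0,y_1/y_0)$ of $p$. If $(\infty,\infty)\in C$, it is called a pole of $r$ if there is a Puiseux series $\varphi\in\mathbb{K}\{\{x^{-1}\}\}$ (rational exponents with a common denominator) such that $p(x,\varphi)=0$, $\deg\varphi>0$ and $\deg r(x,\varphi)>0$. A point $(s_1,s_2)\in C$ is called a pole of $r$ if there is a transformation $T=(T_1,T_2)$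 of $\mathbb{P}^1(\mathbb{K})\times\mathbb{P}^1(\mathbb{K})$, with $T_1,T_2$ invertible fractional linear maps, that maps $(s_1,s_2)$ to $(\infty,\infty)$ and is such that $(\infty,\infty)$ is a pole of $r\circ T^{-1}$ on the curve associated with the numerator of $p\circ T^{-1}$. Let $\sim$ be the smallest equivalence relation on $C$ such that $(a,b)\sim(c,d)$ whenever $a=c$ or $b=d$; its equivalence classes are called orbits. The graph of an orbit $\mathcal{O}$ has the elements of $\mathcal{O}$ as its vertices, and two distinct vertices are adjacent if they have the same first or the same second coordinate. An infinite path is a sequence $v_0,v_1,v_2,\dots$ of vertices with $v_i$ adjacent to $v_{i+1}$ for all $i$; it is cycle-free if there are no $i<j$ with $v_i=v_j$. For a subset $S$ of an orbit $\mathcal{O}$, let $\mathcal{O}(S)$ be the set of all $v\in\mathcal{O}$ for which there is no infinite cycle-free path in the graph of $\mathcal{O}$ that contains $v$ but no element of $S$. The boundary of a set $A\subseteq\mathcal{O}$ is the set of those $v\in A$ that are adjacent to some element of $\mathcal{O}\setminus A$. Let $\mathcal{O}$ be an orbit, and let $S\subseteq\mathcal{O}$ be the set of those poles $v$ of $r$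 in $\mathcal{O}$ for which there is an infinite cycle-free path in the graph of $\mathcal{O}$ that starts at $v$ and contains no pole of $r$ other than $v$. Then: 1. $\mathcal{O}(S)$ is finite; 2. every $(s_1,s_2)\in\mathcal{O}$ for which $s_1$ is a pole of $f$ or $s_2$ is a pole of $g$ belongs to $\mathcal{O}(S)$; 3. the boundary of $\mathcal{O}(S)$ is $S$; in particular, $S$ is finite, $S=\{p_1,\dots,p_k\}$, and $\mathcal{O}(S)=\mathcal{O}(p_1,\dots,p_k)$. -/

import Mathlib

noncomputable section

namespace SepVar

open scoped OnePoint

/-- The polynomial ring `K[x, y]`; `x` is `X 0` and `y` is `X 1`. -/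
abbrev Poly2 (K : Type*) [Field K] := MvPolynomial (Fin 2) K

/-- The field `K(x, y)`. -/
abbrev RatFun (K : Type*) [Field K] := FractionRing (Poly2 K)

/-- `P¹(K) × P¹(K)`, where `P¹(K) = K ∪ {∞}`. -/
abbrev Pt (K : Type*) [Field K] := OnePoint K × OnePoint K

variable {K : Type*} [Field K]

/-- The value `r(u, v) = rₙ(u, v) / r_d(u, v)` of a rational function `r = rₙ / r_d` in reduced
form at elements `u, v` of an extension field. -/
def evalRat {L : Type*} [Field L] [Algebra K L] (u v : L) (r : RatFun K) : L :=
  MvPolynomial.aeval ![u, v] (IsFractionRing.num (Poly2 K) r) /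
    MvPolynomial.aeval ![u, v] (IsFractionRing.den (Poly2 K) r : Poly2 K)

/-! ### The local ring at `p` and the set `F(r, p)` -/

/-- `K[x, y]_p`: the rational functions whose denominator is not divisible by `p`. -/
def localRing (p : Poly2 K) : Set (RatFun K) :=
  {r | ¬ p ∣ (IsFractionRing.den (Poly2 K) r : Poly2 K)}

/-- The ideal `⟨p⟩` of `K[x, y]_p`. -/
def localIdeal (p : Poly2 K) : Set (RatFun K) :=
  {r | ∃ q ∈ localRing p, r = q * algebraMap (Poly2 K) (RatFun K) p}

/-- `f ∈ K(x)`, for `i = 0`, or `f ∈ K(y)`, for `i = 1`, as an element of `K(x, y)`. -/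
def embed (i : Fin 2) (f : RatFunc K) : RatFun K :=
  RatFunc.eval (algebraMap K (RatFun K)) (algebraMap (Poly2 K) (RatFun K) (MvPolynomial.X i)) f

/-- `F(r, p) = {(f, g) ∈ K(x) × K(y) : f - g ∈ r + ⟨p⟩}`. -/
def sepSet (r : RatFun K) (p : Poly2 K) : Set (RatFunc K × RatFunc K) :=
  {fg | embed 0 fg.1 - embed 1 fg.2 - r ∈ localIdeal p}

/-! ### Poles of univariate rational functions -/

/-- `m(s, f)`: the negative of the valuation of `f` at `s ∈ K ∪ {∞}` (and `0` for `f = 0`). -/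
def poleMult (s : OnePoint K) (f : RatFunc K) : ℤ :=
  match s with
  | ∞ => f.num.natDegree - f.denom.natDegree
  | (a : K) => f.denom.rootMultiplicity a - f.num.rootMultiplicity a

/-- `s` is a pole of `f`. -/
def IsUnivPole (f : RatFunc K) (s : OnePoint K) : Prop := 0 < poleMult s f

/-! ### The curve in `P¹ × P¹` -/

/-- The bi-homogenization of `p`, in the variables `x₀ = inl 0`, `x₁ = inl 1`, `y₀ = inr 0`,
`y₁ = inr 1`: the polynomial `x₀ ^ deg_x p * y₀ ^ deg_y p * p (x₁ / x₀, y₁ / y₀)`. -/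
def biHom (p : Poly2 K) : MvPolynomial (Fin 2 ⊕ Fin 2) K :=
  ∑ m ∈ p.support, MvPolynomial.C (p.coeff m) *
    (MvPolynomial.X (Sum.inl 0) ^ (p.degreeOf 0 - m 0) * MvPolynomial.X (Sum.inl 1) ^ m 0) *
    (MvPolynomial.X (Sum.inr 0) ^ (p.degreeOf 1 - m 1) * MvPolynomial.X (Sum.inr 1) ^ m 1)

/-- Homogeneous coordinates: `(1 : a)` for `a ∈ K`, and `(0 : 1)` for `∞`. -/
def coords (s : OnePoint K) : Fin 2 → K :=
  match s with
  | ∞ => ![0, 1]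
  | (a : K) => ![1, a]

/-- The curve in `P¹ × P¹` associated with the bi-homogenization of `p`. -/
def curve (p : Poly2 K) : Set (Pt K) :=
  {s | MvPolynomial.eval (Sum.elim (coords s.1) (coords s.2)) (biHom p) = 0}

/-! ### Poles of `r` on the curve -/

/-- A generalized power series with rational exponents is a Puiseux series if its exponents have a
common denominator. -/
def IsPuiseux (φ : HahnSeries ℚ K) : Prop :=
  ∃ N : ℕ, 0 < N ∧ ∀ α ∈ φ.support, ∃ m : ℤ, α * N = m

/-- The element `x` of `K{{x⁻¹}}`; the series variable is `x⁻¹`. -/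
def serX (K : Type*) [Field K] : HahnSeries ℚ K := HahnSeries.single (-1) 1

/-- The degree in `x` of an element of `K{{x⁻¹}}` (with value `0` at the zero series; only the
positivity of degrees is used). -/
def serDeg (φ : HahnSeries ℚ K) : ℚ := -φ.order

/-- `(∞, ∞)` is a pole of `r` on the curve associated with `p`. -/
def IsPoleAtInfty (r : RatFun K) (p : Poly2 K) : Prop :=
  ((∞, ∞) : Pt K) ∈ curve p ∧
    ∃ φ : HahnSeries ℚ K, IsPuiseux φ ∧ MvPolynomial.aeval ![serX K, φ] p = 0 ∧
      0 < serDeg φ ∧ 0 < serDeg (evalRat (serX K) φ r)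

/-- The fractional linear expression `(a z + b) / (c z + d)` in `K(x, y)`, where `z` is `x`, for
`i = 0`, or `y`, for `i = 1`, and `A = (a b; c d)`. -/
def moebius (A : GL (Fin 2) K) (i : Fin 2) : RatFun K :=
  let z : RatFun K := algebraMap (Poly2 K) (RatFun K) (MvPolynomial.X i)
  let k : K → RatFun K := algebraMap K (RatFun K)
  (k (A.1 0 0) * z + k (A.1 0 1)) / (k (A.1 1 0) * z + k (A.1 1 1))

/-- `r ∘ T` for the transformation `T = (A, B)` of `P¹ × P¹`. -/
def ratComp (r : RatFun K) (A B : GL (Fin 2) K) : RatFun K :=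
  evalRat (moebius A 0) (moebius B 1) r

/-- The numerator of `p ∘ T` for the transformation `T = (A, B)` of `P¹ × P¹`. -/
def polyComp (p : Poly2 K) (A B : GL (Fin 2) K) : Poly2 K :=
  IsFractionRing.num (Poly2 K)
    (MvPolynomial.aeval ![moebius A 0, moebius B 1] p : RatFun K)

open Classical in
/-- The point `s` is a pole of `r` on the curve associated with `p`: some transformation
`T = (A, B)` of `P¹ × P¹` maps `s` to `(∞, ∞)`, and the latter is a pole of `r ∘ T⁻¹` on the curve
associated with the numerator of `p ∘ T⁻¹`. -/
def IsPole (r : RatFun K) (p : Poly2 K) (s : Pt K) : Prop :=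
  s ∈ curve p ∧ ∃ A B : GL (Fin 2) K, A • s.1 = ∞ ∧ B • s.2 = ∞ ∧
    IsPoleAtInfty (ratComp r A⁻¹ B⁻¹) (polyComp p A⁻¹ B⁻¹)

/-! ### Orbits and their graphs -/

/-- The smallest equivalence relation on the curve that relates any two points with the same first
or the same second coordinate. -/
def orbitSetoid (p : Poly2 K) : Setoid (curve p) :=
  Relation.EqvGen.setoid fun v w => v.1.1 = w.1.1 ∨ v.1.2 = w.1.2

/-- `O` is an orbit, i.e. an equivalence class of `orbitSetoid p`. -/
def IsOrbit {p : Poly2 K} (O : Set (curve p)) : Prop := O ∈ (orbitSetoid p).classes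

/-- The graph of an orbit: two (distinct) elements are adjacent if they share a coordinate. -/
def orbitGraph {p : Poly2 K} (O : Set (curve p)) : SimpleGraph O where
  Adj v w := v ≠ w ∧ (v.1.1.1 = w.1.1.1 ∨ v.1.1.2 = w.1.1.2)
  symm := ⟨fun _ _ h => ⟨h.1.symm, h.2.imp Eq.symm Eq.symm⟩⟩
  loopless := ⟨fun _ h => h.1 rfl⟩

/-- `v 0, v 1, v 2, …` is an infinite path of `G` that contains no cycle, i.e. no finite subpath
`v i, …, v j` with `i < j` and `v i = v j`. -/
def IsInfCycleFreePath {V : Type*} (G : SimpleGraph V) (v : ℕ → V) : Prop :=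
  (∀ i, G.Adj (v i) (v (i + 1))) ∧ ∀ i j, i < j → v i ≠ v j

/-- The poles of `r` in `O` at which an infinite cycle-free path in the graph of `O` starts that
does not contain any other pole of `r`. -/
def specialPoles (r : RatFun K) {p : Poly2 K} (O : Set (curve p)) : Set O :=
  {s | IsPole r p s.1.1 ∧ ∃ v : ℕ → O, IsInfCycleFreePath (orbitGraph O) v ∧ v 0 = s ∧
    ∀ i, IsPole r p (v i).1.1 → v i = s}

/-- `O(S)`: the elements `v` of `O` for which there is no infinite cycle-free path that contains
`v` but no element of `S`. -/
def enclosed {p : Poly2 K} (O : Set (curve p)) (S : Set O) : Set O :=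
  {v | ¬ ∃ w : ℕ → O, IsInfCycleFreePath (orbitGraph O) w ∧ (∃ i, w i = v) ∧ ∀ i, w i ∉ S}

/-- The boundary of a set of vertices: its elements that have a neighbour outside of it. -/
def vertexBoundary {V : Type*} (G : SimpleGraph V) (A : Set V) : Set V :=
  {v | v ∈ A ∧ ∃ w, w ∉ A ∧ G.Adj v w}

end SepVar

end

noncomputable section

namespace SepVar

open Polynomial
open scoped OnePoint

variable {K : Type*} [Field K]

/-! On a branch of the curve, parametrized by series with nonconstant coordinates, `r` takes the
value `f - g`. Let P be the set of poles of `r` in the orbit and B the set of points at which `f` or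
`g` has a pole. A pole of `r` forces a pole of `f` or `g`, so P ⊆ B (`IsPole.isUnivPole_or`).
Conversely, where exactly one of `f` and `g` has a pole nothing can cancel, so the point lies in P
(`isPole_of_isUnivPole`); this needs a branch through the given point, which the Newton–Puiseux
theorem supplies (`exists_puiseux_root`, `exists_branch`). Hence at a point of B outside P both `f`
and `g` have a pole, and every neighbour inherits one of them through the shared coordinate: B can
be left only from a point of P. Moreover B is finite, since `f` and `g` have finitely many poles and
every horizontal or vertical line meets the curve in finitely many points.

The rest is graph theory. An infinite cycle-free path through the finite set B has a last point in
B. That point is in P and the path beyond it avoids P, so it belongs to S; thus B ⊆ O(S)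
(`subset_enclosure_exits`). As S ⊆ B is finite and the graph is connected and locally finite,
König's lemma makes O(S) finite (`exists_infinite_path`, `finite_enclosure`). The boundary is found
by extending or truncating escaping paths (`vertexBoundary_enclosure_exits`). -/

open Polynomial IsLocalRing Function in
open scoped Ring in
/-- Hensel's lemma for a simple root of a polynomial that need not be monic. -/
theorem exists_isRoot_of_isUnit_derivative {R : Type*} [CommRing R] (I : Ideal R)
    [IsAdicComplete I R] (f : R[X]) (a₀ : R) (h₁ : f.eval a₀ ∈ I)
    (h₂ : IsUnit (Ideal.Quotient.mk I (f.derivative.eval a₀))) :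
    ∃ a : R, f.IsRoot a ∧ a - a₀ ∈ I := by
  classical
  let f' := derivative f
  -- Newton iteration. The total inverse `⁻¹ʳ` is a true inverse here, because `f'.eval (c n)` stays
  -- a unit modulo `I`, and `I` lies in the Jacobson radical.
  let c : ℕ → R := fun n => Nat.recOn n a₀ fun _ b => b - f.eval b * (f'.eval b)⁻¹ʳ
  have hc : ∀ n, c (n + 1) = c n - f.eval (c n) * (f'.eval (c n))⁻¹ʳ := by
    intro n
    simp only [c]
  have hc_mod : ∀ n, c n ≡ a₀ [SMOD I] := by
    intro n
    induction n with
    | zero => rfl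
    | succ n ih => ?_
    rw [hc, sub_eq_add_neg, ← add_zero a₀]
    refine ih.add ?_
    rw [SModEq.zero, Ideal.neg_mem_iff]
    refine I.mul_mem_right _ ?_
    rw [← SModEq.zero] at h₁ ⊢
    exact (ih.eval f).trans h₁
  have hf'c : ∀ n, IsUnit (f'.eval (c n)) := by
    intro n
    have := isLocalHom_of_le_jacobson_bot I (IsAdicComplete.le_jacobson_bot I)
    apply IsUnit.of_map (Ideal.Quotient.mk I)
    convert! h₂ using 1
    exact SModEq.def.mp ((hc_mod n).eval _)
  have hfcI : ∀ n, f.eval (c n) ∈ I ^ (n + 1) := by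
    intro n
    induction n with
    | zero => simpa only [Nat.rec_zero, zero_add, pow_one] using! h₁
    | succ n ih => ?_
    -- In the Taylor expansion at `c n` the terms of degree 0 and 1 cancel by the choice of the
    -- correction; the others lie in `I ^ (2 * (n + 1))`.
    rw [← taylor_eval_sub (c n), hc, sub_eq_add_neg, sub_eq_add_neg,
      add_neg_cancel_comm]
    rw [eval_eq_sum, sum_over_range' _ _ _ (lt_add_of_pos_right _ zero_lt_two), ←
      Finset.sum_range_add_sum_Ico _ (Nat.le_add_left _ _)]
    swap
    · intro i
      rw [zero_mul]
    refine Ideal.add_mem _ ?_ ?_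
    · rw [← one_add_one_eq_two, Finset.sum_range_succ, Finset.range_one, Finset.sum_singleton,
        taylor_coeff_zero, taylor_coeff_one, pow_zero, pow_one, mul_one, mul_neg,
        mul_left_comm, Ring.mul_inverse_cancel _ (hf'c n), mul_one, add_neg_cancel]
      exact Ideal.zero_mem _
    · refine Submodule.sum_mem _ ?_
      simp only [Finset.mem_Ico]
      rintro i ⟨h2i, _⟩
      have aux : n + 2 ≤ i * (n + 1) := by trans 2 * (n + 1) <;> nlinarith only [h2i]
      refine Ideal.mul_mem_left _ _ (Ideal.pow_le_pow_right aux ?_)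
      rw [pow_mul']
      exact Ideal.pow_mem_pow ((Ideal.neg_mem_iff _).2 <| Ideal.mul_mem_right _ _ ih) _
  have aux : ∀ m n, m ≤ n → c m ≡ c n [SMOD (I ^ m • ⊤ : Ideal R)] := by
    intro m n hmn
    rw [← Ideal.one_eq_top, Ideal.smul_eq_mul, mul_one]
    obtain ⟨k, rfl⟩ := Nat.exists_eq_add_of_le hmn
    clear hmn
    induction k with
    | zero => rw [add_zero]
    | succ k ih => ?_
    rw [← add_assoc, hc, ← add_zero (c m), sub_eq_add_neg]
    refine ih.add ?_
    symm
    rw [SModEq.zero, Ideal.neg_mem_iff]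
    refine Ideal.mul_mem_right _ _ (Ideal.pow_le_pow_right ?_ (hfcI _))
    rw [add_assoc]
    exact le_self_add
  obtain ⟨a, ha⟩ := IsPrecomplete.prec' c (aux _ _)
  refine ⟨a, ?_, ?_⟩
  · show f.IsRoot a
    suffices ∀ n, f.eval a ≡ 0 [SMOD (I ^ n • ⊤ : Ideal R)] by exact IsHausdorff.haus' _ this
    intro n
    specialize ha n
    rw [← Ideal.one_eq_top, Ideal.smul_eq_mul, mul_one] at ha ⊢
    refine (ha.symm.eval f).trans ?_
    rw [SModEq.zero]
    exact Ideal.pow_le_pow_right le_self_add (hfcI _)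
  · show a - a₀ ∈ I
    specialize ha (0 + 1)
    rw [hc, pow_one, ← Ideal.one_eq_top, Ideal.smul_eq_mul, mul_one, sub_eq_add_neg] at ha
    rw [← SModEq.sub_mem, ← add_zero a₀]
    refine ha.symm.trans (SModEq.rfl.add ?_)
    rw [SModEq.zero, Ideal.neg_mem_iff]
    exact Ideal.mul_mem_right _ _ h₁

/-! ### The Newton–Puiseux theorem -/

/-- The substitution `t ↦ t ^ N` as an endomorphism of `K[[t]]`. -/
abbrev expandHom (K : Type*) [Field K] (N : ℕ) (hN : N ≠ 0) : PowerSeries K →+* PowerSeries K :=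
  (PowerSeries.expand (R := K) N hN : PowerSeries K →ₐ[K] PowerSeries K)

/-- A power series root lifting a simple root `0` of the reduction of a polynomial. -/
theorem exists_powerSeries_root_of_simple (F : Polynomial (PowerSeries K))
    (h0 : PowerSeries.constantCoeff (F.coeff 0) = 0)
    (h1 : PowerSeries.constantCoeff (F.coeff 1) ≠ 0) :
    ∃ a : PowerSeries K, F.eval a = 0 ∧ PowerSeries.constantCoeff a = 0 := by
  obtain ⟨a, ha, ha'⟩ := exists_isRoot_of_isUnit_derivative
    (.span {PowerSeries.X} : Ideal (PowerSeries K)) F 0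
    (by rw [Ideal.mem_span_singleton, PowerSeries.X_dvd_iff, ← coeff_zero_eq_eval_zero, h0])
    (IsUnit.map _ (by
      rw [PowerSeries.isUnit_iff_constantCoeff, ← coeff_zero_eq_eval_zero, coeff_derivative]
      simpa using h1))
  rw [Ideal.mem_span_singleton, PowerSeries.X_dvd_iff, sub_zero] at ha'
  exact ⟨a, ha, ha'⟩

/-- A polynomial of degree `d` over an algebraically closed field of characteristic zero whose
second coefficient vanishes and which is not a monomial has a root of multiplicity less than `d`. -/
theorem exists_root_of_multiplicity_lt [IsAlgClosed K] [CharZero K] (q : K[X]) (d i : ℕ)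
    (hd : q.coeff d ≠ 0) (hgt : ∀ j, d < j → q.coeff j = 0) (hpred : q.coeff (d - 1) = 0)
    (hi : i < d) (hqi : q.coeff i ≠ 0) :
    ∃ c : K, ∃ e, 0 < e ∧ e < d ∧ (∀ j < e, (taylor c q).coeff j = 0) ∧
      (taylor c q).coeff e ≠ 0 := by
  have hdeg : q.natDegree = d := by
    refine le_antisymm (natDegree_le_iff_coeff_eq_zero.2 hgt) (le_natDegree_of_ne_zero hd)
  have hq : q ≠ 0 := by rintro rfl; simp at hd
  obtain ⟨c, hc⟩ := IsAlgClosed.exists_root q (by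
    rw [degree_eq_natDegree hq, hdeg]; exact_mod_cast (by omega : d ≠ 0))
  have hT : taylor c q ≠ 0 := by simpa using hq
  refine ⟨c, (taylor c q).natTrailingDegree, ?_, ?_, ?_, ?_⟩
  · rw [Nat.pos_iff_ne_zero, ne_eq, natTrailingDegree_eq_zero]
    simp [hT, taylor_coeff_zero, hc.eq_zero]
  · refine lt_of_le_of_ne ((natTrailingDegree_le_natDegree _).trans_eq
      (by rw [natDegree_taylor, hdeg])) fun h => ?_
    -- If `c` had multiplicity `d`, then `q = a (X - c) ^ d`. Its coefficient `-d c a` at `d - 1`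
    -- vanishes, so `c = 0` in characteristic zero and `q` would be a monomial.
    have hmon : taylor c q = C (q.coeff d) * X ^ d := by
      ext j
      rw [coeff_C_mul_X_pow]
      rcases lt_trichotomy j d with hj | rfl | hj
      · rw [if_neg hj.ne, coeff_eq_zero_of_lt_natTrailingDegree (h ▸ hj)]
      · rw [if_pos rfl, ← hdeg, coeff_taylor_natDegree, leadingCoeff]
      · rw [if_neg hj.ne', coeff_eq_zero_of_natDegree_lt (by rwa [natDegree_taylor, hdeg])]
    have hq' : q = C (q.coeff d) * (X - C c) ^ d := by
      have := congrArg (taylor (-c)) hmon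
      rw [taylor_taylor, neg_add_cancel, taylor_zero, taylor_mul, taylor_C, taylor_X_pow] at this
      simpa [sub_eq_add_neg] using this
    have hc0 : c = 0 := by
      rw [hq', coeff_C_mul, sub_eq_add_neg, ← C_neg, coeff_X_add_C_pow] at hpred
      have h1 : d - (d - 1) = 1 := by omega
      have h2 : (d.choose (d - 1) : K) ≠ 0 := by
        exact_mod_cast (Nat.choose_pos (Nat.sub_le d 1)).ne'
      simpa [h1, h2, hd] using hpred
    rw [hq', hc0, coeff_C_mul] at hqi
    simp [coeff_X_pow, hi.ne] at hqi
  · exact fun j hj => coeff_eq_zero_of_lt_natTrailingDegree hj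
  · simpa [natTrailingDegree, trailingCoeff] using trailingCoeff_nonzero_iff_nonzero.2 hT

/-- The scaling step of the Newton–Puiseux algorithm. -/
theorem exists_newton_polygon_step (Q : Polynomial (PowerSeries K)) (d : ℕ)
    (hlt : ∀ i < d, PowerSeries.constantCoeff (Q.coeff i) = 0)
    (hd : PowerSeries.constantCoeff (Q.coeff d) ≠ 0) (h0 : Q.coeff 0 ≠ 0)
    (hpred : Q.coeff (d - 1) = 0) :
    ∃ (M : ℕ) (hM : M ≠ 0) (ν : ℕ) (_ : ν ≠ 0) (Q' : Polynomial (PowerSeries K)),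
      (Q.map (expandHom K M hM)).comp
        (C (PowerSeries.X ^ ν) * X) = C (PowerSeries.X ^ (d * ν)) * Q' ∧
      PowerSeries.constantCoeff (Q'.coeff d) ≠ 0 ∧
      (∀ j, d < j → PowerSeries.constantCoeff (Q'.coeff j) = 0) ∧
      PowerSeries.constantCoeff (Q'.coeff (d - 1)) = 0 ∧
      ∃ i < d, PowerSeries.constantCoeff (Q'.coeff i) ≠ 0 := by
  classical
  have hdpos : 0 < d := by
    rcases Nat.eq_zero_or_pos d with rfl | h
    · exact absurd hpred h0
    · exact h
  let o : ℕ → ℕ := fun i => (Q.coeff i).order.toNat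
  have ho : ∀ i, Q.coeff i ≠ 0 → (Q.coeff i).order = o i := fun i hi =>
    (PowerSeries.coe_toNat_order hi).symm
  -- This selects the edge of the Newton polygon that ends at `(d, 0)`. Its slope is `ν / M` with `ν
  -- = o i₀` and `M = d - i₀`, so it becomes the integer `ν` after `t ↦ t ^ M`.
  obtain ⟨i₀, hi₀, hmin⟩ := Finset.exists_min_image
    ((Finset.range d).filter fun i => Q.coeff i ≠ 0) (fun i => (o i : ℚ) / (d - i : ℕ))
    ⟨0, by simp [hdpos, h0]⟩
  simp only [Finset.mem_filter, Finset.mem_range] at hi₀ hmin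
  obtain ⟨hi₀d, hi₀0⟩ := hi₀
  have hM : d - i₀ ≠ 0 := by omega
  have hν : o i₀ ≠ 0 := by
    intro h
    have h1 : (Q.coeff i₀).order = 0 := by rw [ho _ hi₀0, h]; rfl
    have := PowerSeries.coeff_order hi₀0
    simp [h1, hlt i₀ hi₀d] at this
  have hle : ∀ i < d, Q.coeff i ≠ 0 → (d - i) * o i₀ ≤ (d - i₀) * o i := by
    intro i hi hi0
    have := hmin i ⟨hi, hi0⟩
    rw [div_le_div_iff₀ (by exact_mod_cast (by omega)) (by exact_mod_cast (by omega))] at this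
    have h2 : o i₀ * (d - i) ≤ o i * (d - i₀) := by exact_mod_cast this
    linarith [mul_comm (o i₀) (d - i), mul_comm (o i) (d - i₀)]
  set M := d - i₀ with hMdef
  set ν := o i₀ with hνdef
  set E : PowerSeries K →+* PowerSeries K :=
    (expandHom K M hM) with hE
  have hEapp : ∀ f, E f = PowerSeries.expand M hM f := fun _ => rfl
  have hcoeff : ∀ i, ((Q.map E).comp (C (PowerSeries.X ^ ν) * X)).coeff i =
      E (Q.coeff i) * PowerSeries.X ^ (ν * i) := by
    intro i
    rw [comp_C_mul_X_coeff, coeff_map, pow_mul]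
  have hord : ∀ i, Q.coeff i ≠ 0 → (E (Q.coeff i)).order = ((M * o i : ℕ) : ℕ∞) := by
    intro i hi
    rw [hEapp, PowerSeries.order_expand, ho i hi]; simp
  have hdvd : C (PowerSeries.X ^ (d * ν)) ∣ (Q.map E).comp (C (PowerSeries.X ^ ν) * X) := by
    rw [C_dvd_iff_dvd_coeff]
    intro i
    rw [hcoeff]
    by_cases hi0 : Q.coeff i = 0
    · simp [hi0]
    by_cases hi : i < d
    · rw [PowerSeries.X_pow_dvd_iff]
      intro m hm
      refine PowerSeries.coeff_of_lt_order _ ?_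
      rw [PowerSeries.order_mul, hord i hi0, PowerSeries.order_X_pow]
      have := hle i hi hi0
      have h3 : d * ν = (d - i) * ν + ν * i := by
        rw [mul_comm ν i, ← add_mul, Nat.sub_add_cancel hi.le]
      exact_mod_cast (by omega : m < M * o i + ν * i)
    · refine Dvd.dvd.mul_left (pow_dvd_pow _ ?_) _
      rw [mul_comm ν]
      exact Nat.mul_le_mul_right _ (not_lt.1 hi)
  obtain ⟨Q', hQ'⟩ := hdvd
  have hX : ∀ n, (PowerSeries.X : PowerSeries K) ^ n ≠ 0 := fun n =>
    pow_ne_zero _ PowerSeries.X_ne_zero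
  have hc : ∀ i, PowerSeries.X ^ (d * ν) * Q'.coeff i = E (Q.coeff i) * PowerSeries.X ^ (ν * i) := by
    intro i
    rw [← hcoeff, hQ', coeff_C_mul]
  refine ⟨M, hM, ν, hν, Q', hQ', ?_, ?_, ?_, i₀, hi₀d, ?_⟩
  · have h := hc d
    rw [mul_comm ν d, mul_comm (E _)] at h
    rw [mul_left_cancel₀ (hX _) h, hEapp, PowerSeries.constantCoeff_expand]
    exact hd
  · intro j hj
    have h := hc j
    obtain ⟨k, rfl⟩ := Nat.exists_eq_add_of_lt hj
    have h4 : ν * (d + k + 1) = d * ν + ν * (k + 1) := by ring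
    rw [h4, pow_add, mul_left_comm] at h
    rw [mul_left_cancel₀ (hX _) h]
    simp [hν]
  · have h := hc (d - 1)
    rw [hpred, map_zero, zero_mul] at h
    rw [(mul_eq_zero.1 h).resolve_left (hX _), map_zero]
  -- The point of index `i₀` lies on the edge itself, so after division by `X ^ (d * ν)` its
  -- coefficient has order exactly 0.
  · have h := congrArg PowerSeries.order (hc i₀)
    have hQ0 : Q'.coeff i₀ ≠ 0 := by
      intro h0
      have := hc i₀
      rw [h0, mul_zero] at this
      rcases mul_eq_zero.1 this.symm with h' | h'
      · have := hord i₀ hi₀0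
        rw [h', PowerSeries.order_zero] at this
        exact ENat.top_ne_natCast _ this
      · exact hX _ h'
    rw [PowerSeries.order_mul, PowerSeries.order_mul, hord i₀ hi₀0, PowerSeries.order_X_pow,
      PowerSeries.order_X_pow, ← PowerSeries.coe_toNat_order hQ0] at h
    have h5 : d * ν + (Q'.coeff i₀).order.toNat = M * ν + ν * i₀ := by exact_mod_cast h
    have h6 : d * ν = M * ν + ν * i₀ := by
      rw [mul_comm ν i₀, ← add_mul, hMdef, Nat.sub_add_cancel hi₀d.le]
    have h7 : (Q'.coeff i₀).order = 0 := by
      rw [← PowerSeries.coe_toNat_order hQ0]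
      exact_mod_cast (by omega : (Q'.coeff i₀).order.toNat = 0)
    have := PowerSeries.coeff_order hQ0
    simpa [h7] using this

/-- The Newton–Puiseux theorem: a polynomial over `K[[t]]` whose reduction is nonzero and vanishes
at `0` has a root in the maximal ideal of some `K[[t ^ (1 / N)]]`. -/
theorem exists_puiseux_root [IsAlgClosed K] [CharZero K] (d : ℕ) :
    ∀ Q : Polynomial (PowerSeries K), 0 < d →
    (∀ i < d, PowerSeries.constantCoeff (Q.coeff i) = 0) →
    PowerSeries.constantCoeff (Q.coeff d) ≠ 0 →
    ∃ (N : ℕ) (hN : N ≠ 0) (ψ : PowerSeries K), PowerSeries.constantCoeff ψ = 0 ∧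
      Q.eval₂ (expandHom K N hN) ψ = 0 := by
  induction d using Nat.strong_induction_on with
  | _ d ih =>
  intro Q hdpos hlt hd
  -- Tschirnhaus shift: translating by a root `α` of the Hasse derivative of order `d - 1` kills the
  -- coefficient of degree `d - 1`. Modulo `t` this derivative has a simple root at 0, since `d ≠ 0`
  -- in `K`.
  obtain ⟨α, hα, hα0⟩ := exists_powerSeries_root_of_simple (hasseDeriv (d - 1) Q)
    (by rw [hasseDeriv_coeff]; simp [hlt (d - 1) (by omega)])
    (by
      rw [hasseDeriv_coeff, show 1 + (d - 1) = d by omega]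
      have h2 : (d.choose (d - 1) : K) ≠ 0 := by
        exact_mod_cast (Nat.choose_pos (Nat.sub_le d 1)).ne'
      simpa [h2] using hd)
  have hred : ∀ i, PowerSeries.constantCoeff ((taylor α Q).coeff i) =
      PowerSeries.constantCoeff (Q.coeff i) := by
    intro i
    rw [← coeff_map, ← coeff_map, map_taylor, hα0, taylor_zero]
  by_cases h0 : (taylor α Q).coeff 0 = 0
  · refine ⟨1, one_ne_zero, α, hα0, ?_⟩
    rw [taylor_coeff_zero] at h0
    have h1 : expandHom K 1 one_ne_zero = RingHom.id _ := by ext1; simp [expandHom]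
    rwa [h1]
  obtain ⟨M, hM, ν, hν, Q', hQ', h1, h2, h3, i, hi, h4⟩ :=
    exists_newton_polygon_step (taylor α Q) d (fun i hi => by rw [hred, hlt i hi])
      (by rwa [hred]) h0 (by rw [taylor_coeff]; exact hα)
  -- A root `c` of multiplicity `e < d` of the reduction makes the induction descend from `d` to
  -- `e`.
  obtain ⟨c, e, he, hed, he1, he2⟩ := exists_root_of_multiplicity_lt
    (Q'.map PowerSeries.constantCoeff) d i (by simpa using h1) (by simpa using h2)
    (by simpa using h3) hi (by simpa using h4)
  have hT : (taylor (PowerSeries.C c) Q').map PowerSeries.constantCoeff =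
      taylor c (Q'.map PowerSeries.constantCoeff) := by
    rw [map_taylor, PowerSeries.constantCoeff_C]
  obtain ⟨N, hN, ψ, hψ0, hψ⟩ := ih e hed (taylor (PowerSeries.C c) Q') he
    (fun j hj => by rw [← coeff_map, hT, he1 j hj]) (by rwa [← coeff_map, hT])
  -- The root undoes the substitutions in turn: translation by `c`, scaling by `X ^ ν`, translation
  -- by `α`, each written in the parameter of the final ramification `N * M`.
  refine ⟨N * M, mul_ne_zero hN hM, PowerSeries.expand N hN (PowerSeries.X ^ ν) *
    (ψ + PowerSeries.C c) + PowerSeries.expand (N * M) (mul_ne_zero hN hM) α, ?_, ?_⟩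
  · simp [hα0, hν, hN]
  · have hψ' : Q'.eval₂ (expandHom K N hN)
        (ψ + PowerSeries.C c) = 0 := by
      rw [taylor_apply, eval₂_comp] at hψ
      simpa [PowerSeries.expand_C] using hψ
    have key := congrArg (eval₂ (expandHom K N hN)
        (ψ + PowerSeries.C c)) hQ'
    rw [eval₂_mul, hψ', mul_zero, eval₂_comp, eval₂_map, taylor_apply, eval₂_comp] at key
    rw [← key]
    have hcomp : (expandHom K N hN).comp
        (expandHom K M hM) =
        (expandHom K (N * M) (mul_ne_zero hN hM)) := by
      ext1 f
      exact (PowerSeries.expand_mul N hN M hM f).symm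
    rw [hcomp]
    congr 1
    simp only [eval₂_add, eval₂_mul, eval₂_C, eval₂_X]
    rfl

/-! ### Puiseux series -/

theorem algebraMap_hahnSeries {Γ : Type*} [Semiring Γ] [PartialOrder Γ] [IsStrictOrderedRing Γ]
    (c : K) : algebraMap K (HahnSeries Γ K) c = HahnSeries.C c := by
  rw [HahnSeries.algebraMap_apply', PowerSeries.algebraMap_apply, HahnSeries.ofPowerSeries_C]
  rfl

/-- The inclusion of `K((t ^ (1 / N)))` in the field of generalized power series. -/
def laurentHom (K : Type*) [Field K] (N : ℕ) (hN : N ≠ 0) :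
    HahnSeries ℤ K →+* HahnSeries ℚ K :=
  HahnSeries.embDomainRingHom
    { toFun := fun n : ℤ => (n : ℚ) / N
      map_zero' := by simp
      map_add' := fun a b => by push_cast; ring }
    (fun a b h => by
      have hN' : (N : ℚ) ≠ 0 := by exact_mod_cast hN
      have h' : (a : ℚ) / N = b / N := h
      field_simp at h'
      exact_mod_cast h')
    (fun a b => by
      have hN' : (0 : ℚ) < N := by exact_mod_cast Nat.pos_of_ne_zero hN
      change (a : ℚ) / N ≤ b / N ↔ a ≤ b
      rw [div_le_div_iff_of_pos_right hN', Int.cast_le])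

/-- The inclusion of `K[[t ^ (1 / N)]]` in the field of generalized power series. -/
def powerSeriesHom (K : Type*) [Field K] (N : ℕ) (hN : N ≠ 0) :
    PowerSeries K →ₐ[K] HahnSeries ℚ K :=
  { (laurentHom K N hN).comp (HahnSeries.ofPowerSeries ℤ K) with
    commutes' := fun c => by
      change laurentHom K N hN (HahnSeries.ofPowerSeries ℤ K (algebraMap K _ c)) = _
      rw [PowerSeries.algebraMap_apply, HahnSeries.ofPowerSeries_C, algebraMap_hahnSeries]
      exact HahnSeries.embDomainRingHom_C }

theorem powerSeriesHom_apply (N : ℕ) (hN : N ≠ 0) (ψ : PowerSeries K) :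
    powerSeriesHom K N hN ψ = laurentHom K N hN (HahnSeries.ofPowerSeries ℤ K ψ) := rfl

theorem isPuiseux_laurentHom (N : ℕ) (hN : N ≠ 0) (z : HahnSeries ℤ K) :
    IsPuiseux (laurentHom K N hN z) := by
  refine ⟨N, Nat.pos_of_ne_zero hN, fun α hα => ?_⟩
  obtain ⟨m, -, rfl⟩ := HahnSeries.support_embDomain_subset hα
  have hN' : (N : ℚ) ≠ 0 := by exact_mod_cast hN
  exact ⟨m, div_mul_cancel₀ _ hN'⟩

theorem powerSeriesHom_X_pow (N : ℕ) (hN : N ≠ 0) :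
    powerSeriesHom K N hN (PowerSeries.X ^ N) = HahnSeries.single 1 1 := by
  have hN' : (N : ℚ) ≠ 0 := by exact_mod_cast hN
  rw [powerSeriesHom_apply, HahnSeries.ofPowerSeries_X_pow]
  refine HahnSeries.embDomain_single.trans ?_
  have : ((N : ℤ) : ℚ) / N = 1 := by simp [hN']
  exact congrArg (fun a => HahnSeries.single a (1 : K)) this

theorem coeff_powerSeriesHom_eq_zero (N : ℕ) (hN : N ≠ 0) (ψ : PowerSeries K)
    (h0 : PowerSeries.constantCoeff ψ = 0) (α : ℚ) (hα : α ≤ 0) :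
    (powerSeriesHom K N hN ψ).coeff α = 0 := by
  by_contra h
  obtain ⟨m, hm, rfl⟩ := HahnSeries.support_embDomain_subset
    ((HahnSeries.mem_support _ _).2 h)
  obtain ⟨n, hn, rfl⟩ := HahnSeries.support_embDomain_subset hm
  have hN' : (0 : ℚ) < N := by exact_mod_cast Nat.pos_of_ne_zero hN
  have hn0 : n = 0 := by
    have h1 : (((n : ℕ) : ℤ) : ℚ) / N ≤ 0 := hα
    rw [div_le_iff₀ hN', zero_mul] at h1
    have h2 : (n : ℚ) ≤ 0 := by exact_mod_cast h1
    exact_mod_cast le_antisymm h2 n.cast_nonneg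
  subst hn0
  refine hn ?_
  simpa using h0

theorem order_powerSeriesHom_pos (N : ℕ) (hN : N ≠ 0) (ψ : PowerSeries K)
    (h0 : PowerSeries.constantCoeff ψ = 0) (h : powerSeriesHom K N hN ψ ≠ 0) :
    0 < (powerSeriesHom K N hN ψ).order := by
  by_contra hle
  exact h (HahnSeries.coeff_order_eq_zero.1
    (coeff_powerSeriesHom_eq_zero N hN ψ h0 _ (not_lt.1 hle)))

/-- The Laurent series in `t ^ (1 / N)` form a field, so inversion keeps the common denominator `N`.
-/
theorem isPuiseux_inv_powerSeriesHom (N : ℕ) (hN : N ≠ 0) (ψ : PowerSeries K) :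
    IsPuiseux (powerSeriesHom K N hN ψ)⁻¹ := by
  rw [powerSeriesHom_apply, ← map_inv₀]
  exact isPuiseux_laurentHom N hN _

/-! ### Orders -/

/-- The case `b = 0` is listed separately because `order` assigns the value 0 to the zero series. -/
theorem order_add_of_lt {a b : HahnSeries ℚ K} (ha : a ≠ 0) (h : b = 0 ∨ a.order < b.order) :
    a + b ≠ 0 ∧ (a + b).order = a.order := by
  rcases eq_or_ne b 0 with rfl | hb
  · simp [ha]
  · have h' := h.resolve_left hb
    have h1 : a.orderTop < b.orderTop := by
      rw [← HahnSeries.order_eq_orderTop_of_ne_zero ha,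
        ← HahnSeries.order_eq_orderTop_of_ne_zero hb]
      exact_mod_cast h'
    have h2 := HahnSeries.orderTop_add_eq_left h1
    have h3 : a + b ≠ 0 := by
      rw [← HahnSeries.orderTop_ne_top, h2, HahnSeries.orderTop_ne_top]
      exact ha
    refine ⟨h3, ?_⟩
    rw [← HahnSeries.order_eq_orderTop_of_ne_zero h3,
      ← HahnSeries.order_eq_orderTop_of_ne_zero ha] at h2
    exact_mod_cast h2

theorem order_inv' {a : HahnSeries ℚ K} : (a⁻¹).order = -a.order := by
  rcases eq_or_ne a 0 with rfl | ha
  · simp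
  · have := HahnSeries.order_mul ha (inv_ne_zero ha)
    rw [mul_inv_cancel₀ ha, HahnSeries.order_one] at this
    linarith

theorem order_div' {a b : HahnSeries ℚ K} (ha : a ≠ 0) (hb : b ≠ 0) :
    (a / b).order = a.order - b.order := by
  rw [div_eq_mul_inv, HahnSeries.order_mul ha (inv_ne_zero hb), order_inv', sub_eq_add_neg]

theorem algebraMap_ne_zero' {c : K} (hc : c ≠ 0) : algebraMap K (HahnSeries ℚ K) c ≠ 0 := by
  simpa using hc

theorem order_algebraMap (c : K) : (algebraMap K (HahnSeries ℚ K) c).order = 0 := by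
  rw [algebraMap_hahnSeries]; exact HahnSeries.order_C

theorem aeval_eq_divX {R : Type*} [CommRing R] [Algebra K R] (u : R) (q : K[X]) :
    aeval u q = aeval u q.divX * u + algebraMap K R (q.coeff 0) := by
  conv_lhs => rw [← divX_mul_X_add q]
  simp

/-- The leading term dominates. The induction on the degree follows Horner's scheme, with `divX`
removing the constant term. -/
theorem order_aeval_of_order_neg {u : HahnSeries ℚ K} (hu : u.order < 0) (n : ℕ) :
    ∀ q : K[X], q ≠ 0 → q.natDegree = n → aeval u q ≠ 0 ∧ (aeval u q).order = n * u.order := by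
  have hu0 : u ≠ 0 := by rintro rfl; simp at hu
  induction n with
  | zero =>
    intro q hq hn
    obtain ⟨c, rfl⟩ := natDegree_eq_zero.1 hn
    have hc : c ≠ 0 := by simpa using hq
    rw [aeval_C]
    exact ⟨algebraMap_ne_zero' hc, by simp [order_algebraMap]⟩
  | succ n ih =>
    intro q hq hn
    have hd : q.divX.natDegree = n := by rw [natDegree_divX_eq_natDegree_tsub_one, hn]; rfl
    have hd0 : q.divX ≠ 0 := by
      intro h
      rw [divX_eq_zero_iff] at h
      rw [h, natDegree_C] at hn
      omega
    obtain ⟨h1, h2⟩ := ih q.divX hd0 hd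
    have h3 : (aeval u q.divX * u).order = ((n + 1 : ℕ) : ℚ) * u.order := by
      rw [HahnSeries.order_mul h1 hu0, h2]; push_cast; ring
    rw [aeval_eq_divX, ← h3]
    refine order_add_of_lt (mul_ne_zero h1 hu0) (Or.inr ?_)
    rw [order_algebraMap, h3]
    exact mul_neg_of_pos_of_neg (by positivity) hu

/-- Here the lowest nonzero term dominates. -/
theorem order_aeval_of_order_pos {u : HahnSeries ℚ K} (hu : 0 < u.order) (n : ℕ) :
    ∀ q : K[X], q ≠ 0 → q.natDegree = n →
      aeval u q ≠ 0 ∧ (aeval u q).order = q.natTrailingDegree * u.order := by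
  have hu0 : u ≠ 0 := by rintro rfl; simp at hu
  induction n with
  | zero =>
    intro q hq hn
    obtain ⟨c, rfl⟩ := natDegree_eq_zero.1 hn
    have hc : c ≠ 0 := by simpa using hq
    rw [aeval_C]
    exact ⟨algebraMap_ne_zero' hc, by simp [order_algebraMap]⟩
  | succ n ih =>
    intro q hq hn
    have hd : q.divX.natDegree = n := by rw [natDegree_divX_eq_natDegree_tsub_one, hn]; rfl
    have hd0 : q.divX ≠ 0 := by
      intro h
      rw [divX_eq_zero_iff] at h
      rw [h, natDegree_C] at hn
      omega
    obtain ⟨h1, h2⟩ := ih q.divX hd0 hd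
    have h3 : (aeval u q.divX * u).order = q.divX.natTrailingDegree * u.order + u.order := by
      rw [HahnSeries.order_mul h1 hu0, h2]
    rw [aeval_eq_divX]
    by_cases hc : q.coeff 0 = 0
    · have h4 : q.natTrailingDegree = q.divX.natTrailingDegree + 1 := by
        have h5 : q = q.divX * X := by
          conv_lhs => rw [← divX_mul_X_add q, hc, C_0, add_zero]
        conv_lhs => rw [h5]
        rw [natTrailingDegree_mul hd0 X_ne_zero, natTrailingDegree_X]
      rw [hc, map_zero, add_zero, h3, h4]
      exact ⟨mul_ne_zero h1 hu0, by push_cast; ring⟩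
    · have h4 : q.natTrailingDegree = 0 := natTrailingDegree_eq_zero.2 (Or.inr hc)
      rw [h4, add_comm, Nat.cast_zero, zero_mul, ← order_algebraMap (q.coeff 0)]
      refine order_add_of_lt (algebraMap_ne_zero' hc) (Or.inr ?_)
      rw [order_algebraMap, h3]
      positivity

/-! ### Generalized power series close to a point of the projective line -/

/-- The series `u` specializes to the point `s` of the projective line, without being equal to it. -/
def Near (s : OnePoint K) (u : HahnSeries ℚ K) : Prop :=
  match s with
  | ∞ => u.order < 0
  | (a : K) => 0 < (u - algebraMap K (HahnSeries ℚ K) a).order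

theorem near_infty {u : HahnSeries ℚ K} : Near ∞ u ↔ u.order < 0 := Iff.rfl

theorem near_coe {a : K} {u : HahnSeries ℚ K} :
    Near (a : OnePoint K) u ↔ 0 < (u - algebraMap K (HahnSeries ℚ K) a).order := Iff.rfl

theorem aeval_eq_aeval_taylor (u : HahnSeries ℚ K) (a : K) (q : K[X]) :
    aeval u q = aeval (u - algebraMap K (HahnSeries ℚ K) a) (taylor a q) := by
  rw [taylor_apply, aeval_comp]
  simp

theorem Near.aeval_ne_zero {s : OnePoint K} {u : HahnSeries ℚ K} (h : Near s u) {q : K[X]}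
    (hq : q ≠ 0) : aeval u q ≠ 0 := by
  induction s using OnePoint.rec with
  | infty => exact (order_aeval_of_order_neg h _ q hq rfl).1
  | coe a =>
    rw [aeval_eq_aeval_taylor u a]
    exact (order_aeval_of_order_pos h _ _ (by simpa using hq) rfl).1

/-- The number `e` is the order of the local parameter along the series: of `u⁻¹` at `∞`, and of `u
- a` at `a`. The orders of numerator and denominator are integer multiples of it. -/
theorem Near.order_ratFunc_eval {s : OnePoint K} {u : HahnSeries ℚ K} (h : Near s u) :
    ∃ e : ℚ, 0 < e ∧ ∀ f : RatFunc K, f ≠ 0 →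
      (f.eval (algebraMap K (HahnSeries ℚ K)) u).order = -poleMult s f * e := by
  have hnum : ∀ f : RatFunc K, f ≠ 0 → f.num ≠ 0 := fun f => RatFunc.num_ne_zero
  have hden : ∀ f : RatFunc K, f.denom ≠ 0 := fun f => f.denom_ne_zero
  induction s using OnePoint.rec with
  | infty =>
    refine ⟨-u.order, neg_pos.2 h, fun f hf => ?_⟩
    obtain ⟨h1, h2⟩ := order_aeval_of_order_neg h _ _ (hnum f hf) rfl
    obtain ⟨h3, h4⟩ := order_aeval_of_order_neg h _ _ (hden f) rfl
    rw [RatFunc.eval, ← aeval_def, ← aeval_def, order_div' h1 h3, h2, h4]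
    simp only [poleMult]
    push_cast
    ring
  | coe a =>
    refine ⟨_, h, fun f hf => ?_⟩
    obtain ⟨h1, h2⟩ := order_aeval_of_order_pos h _ (taylor a f.num)
      (by simpa using hnum f hf) rfl
    obtain ⟨h3, h4⟩ := order_aeval_of_order_pos h _ (taylor a f.denom) (by simpa using hden f) rfl
    rw [RatFunc.eval, ← aeval_def, ← aeval_def, aeval_eq_aeval_taylor u a,
      aeval_eq_aeval_taylor u a f.denom, order_div' h1 h3, h2, h4]
    simp only [poleMult, rootMultiplicity_eq_natTrailingDegree, taylor_apply]
    push_cast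
    ring

theorem Near.serDeg_pos_iff {s : OnePoint K} {u : HahnSeries ℚ K} (h : Near s u) (f : RatFunc K) :
    0 < serDeg (f.eval (algebraMap K (HahnSeries ℚ K)) u) ↔ IsUnivPole f s := by
  rcases eq_or_ne f 0 with rfl | hf
  · have h0 : poleMult s (0 : RatFunc K) = 0 := by
      induction s using OnePoint.rec with
      | infty => simp [poleMult]
      | coe a => simp [poleMult]
    simp [serDeg, IsUnivPole, h0]
  · obtain ⟨e, he, H⟩ := h.order_ratFunc_eval
    rw [serDeg, H f hf, IsUnivPole, neg_mul, neg_neg, mul_pos_iff_of_pos_right he]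
    exact_mod_cast Iff.rfl

/-- This is the ultrametric inequality, stated through `orderTop` so that zero series need no
separate treatment. -/
theorem min_serDeg_le {a b : HahnSeries ℚ K} (h : 0 < serDeg (a - b)) :
    0 < serDeg a ∨ 0 < serDeg b := by
  by_contra! H
  simp only [serDeg, neg_pos, neg_nonpos] at h H
  have h1 : (0 : WithTop ℚ) ≤ a.orderTop := HahnSeries.zero_le_orderTop_iff.2 H.1
  have h2 : (0 : WithTop ℚ) ≤ b.orderTop := HahnSeries.zero_le_orderTop_iff.2 H.2
  have h3 := (le_min h1 h2).trans HahnSeries.min_orderTop_le_orderTop_sub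
  exact absurd (HahnSeries.zero_le_orderTop_iff.1 h3) (not_le.2 h)

theorem serDeg_add_pos {a b : HahnSeries ℚ K} (ha : 0 < serDeg a) (hb : ¬ 0 < serDeg b) :
    0 < serDeg (a + b) := by
  have ha0 : a ≠ 0 := by rintro rfl; simp [serDeg] at ha
  simp only [serDeg, neg_pos, not_lt] at ha hb ⊢
  rw [(order_add_of_lt ha0 (Or.inr (ha.trans_le hb))).2]
  exact ha

/-! ### Fractional linear maps -/

/-- The fractional linear expression `(a z + b) / (c z + d)`. -/
def mobius {L : Type*} [Field L] [Algebra K L] (A : GL (Fin 2) K) (z : L) : L :=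
  (algebraMap K L (A.1 0 0) * z + algebraMap K L (A.1 0 1)) /
    (algebraMap K L (A.1 1 0) * z + algebraMap K L (A.1 1 1))

/-- Invertibility of `A` makes `c X + d` a nonzero polynomial, and no nonzero polynomial vanishes at
a series of negative order. -/
theorem mobius_denominator_ne_zero (A : GL (Fin 2) K) {w : HahnSeries ℚ K} (hw : w.order < 0) :
    algebraMap K (HahnSeries ℚ K) (A.1 1 0) * w + algebraMap K (HahnSeries ℚ K) (A.1 1 1) ≠ 0 := by
  have hq : C (A.1 1 0) * X + C (A.1 1 1) ≠ (0 : K[X]) := by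
    intro h
    have h1 := congrArg (fun q => coeff q 1) h
    have h0 := congrArg (fun q => coeff q 0) h
    simp only [coeff_add, coeff_C_mul, coeff_X_one, coeff_C_succ, coeff_X_zero, coeff_C_zero,
      coeff_zero, mul_one, mul_zero, add_zero, zero_add] at h0 h1
    refine A.det_ne_zero ?_
    rw [Matrix.det_fin_two]
    change A.1 0 0 * A.1 1 1 - A.1 0 1 * A.1 1 0 = 0
    rw [h0, h1]; ring
  have := (order_aeval_of_order_neg hw _ _ hq rfl).1
  simpa using this

-- For `c ≠ 0` the difference between `(a w + b) / (c w + d)` and `a / c` is `-det A / (c (c w +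
-- d))`, of positive order. For `c = 0` the map is affine and preserves the order of `w`.
open Classical in
theorem near_mobius (A : GL (Fin 2) K) {w : HahnSeries ℚ K} (hw : w.order < 0) :
    Near (A • (∞ : OnePoint K)) (mobius A w) := by
  have hw0 : w ≠ 0 := by rintro rfl; simp at hw
  have hden := mobius_denominator_ne_zero A hw
  have hdet : A.1 0 0 * A.1 1 1 - A.1 0 1 * A.1 1 0 ≠ 0 := by
    have := A.det_ne_zero
    rwa [Matrix.det_fin_two] at this
  rw [OnePoint.smul_infty_eq_ite]
  change Near (if A.1 1 0 = 0 then ∞ else ((A.1 0 0 / A.1 1 0 : K) : OnePoint K)) _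
  have key : ∀ a b : K, a ≠ 0 →
      algebraMap K (HahnSeries ℚ K) a * w + algebraMap K (HahnSeries ℚ K) b ≠ 0 ∧
      (algebraMap K (HahnSeries ℚ K) a * w + algebraMap K (HahnSeries ℚ K) b).order = w.order := by
    intro a b ha
    have h1 : (algebraMap K (HahnSeries ℚ K) a * w).order = w.order := by
      rw [HahnSeries.order_mul (algebraMap_ne_zero' ha) hw0, order_algebraMap, zero_add]
    rw [← h1]
    refine order_add_of_lt (mul_ne_zero (algebraMap_ne_zero' ha) hw0) (Or.inr ?_)
    rwa [h1, order_algebraMap]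
  split_ifs with hc
  · have ha : A.1 0 0 ≠ 0 := by
      intro h; rw [h, hc] at hdet; simp at hdet
    rw [near_infty, mobius, order_div' (key _ _ ha).1 hden, (key _ _ ha).2, hc, map_zero, zero_mul,
      zero_add, order_algebraMap, sub_zero]
    exact hw
  · have hc' := algebraMap_ne_zero' hc
    have h1 : mobius A w - algebraMap K (HahnSeries ℚ K) (A.1 0 0 / A.1 1 0) =
        algebraMap K (HahnSeries ℚ K) (-(A.1 0 0 * A.1 1 1 - A.1 0 1 * A.1 1 0) / A.1 1 0) /
          (algebraMap K (HahnSeries ℚ K) (A.1 1 0) * w +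
            algebraMap K (HahnSeries ℚ K) (A.1 1 1)) := by
      rw [mobius]
      simp only [map_div₀, map_neg, map_sub, map_mul]
      rw [div_sub_div _ _ hden hc', div_div]
      congr 1 <;> ring
    rw [near_coe, h1, order_div' (algebraMap_ne_zero' (div_ne_zero (neg_ne_zero.2 hdet) hc)) hden,
      order_algebraMap, (key _ _ hc).2]
    simpa using hw

/-! ### Evaluation of rational functions in two variables -/

section Evaluation

variable {L : Type*} [Field L] [Algebra K L]

/-- The rational function `r` is defined at `(u, v)` and has the value `z` there. -/
def HasValue (u v : L) (r : RatFun K) (z : L) : Prop :=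
  ∃ a b : Poly2 K, MvPolynomial.aeval ![u, v] b ≠ 0 ∧
    r * algebraMap (Poly2 K) (RatFun K) b = algebraMap (Poly2 K) (RatFun K) a ∧
    z * MvPolynomial.aeval ![u, v] b = MvPolynomial.aeval ![u, v] a

variable {u v : L} {r r' : RatFun K} {z z' : L}

theorem hasValue_algebraMap (a : Poly2 K) :
    HasValue u v (algebraMap (Poly2 K) (RatFun K) a) (MvPolynomial.aeval ![u, v] a) :=
  ⟨a, 1, by simp, by simp, by simp⟩

theorem hasValue_const (c : K) : HasValue u v (algebraMap K (RatFun K) c) (algebraMap K L c) := by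
  have := hasValue_algebraMap (u := u) (v := v) (MvPolynomial.C c : Poly2 K)
  rwa [MvPolynomial.aeval_C, ← MvPolynomial.algebraMap_eq, ← IsScalarTower.algebraMap_apply] at this

theorem HasValue.add (h : HasValue u v r z) (h' : HasValue u v r' z') :
    HasValue u v (r + r') (z + z') := by
  obtain ⟨a, b, hb, h1, h2⟩ := h
  obtain ⟨a', b', hb', h1', h2'⟩ := h'
  refine ⟨a * b' + a' * b, b * b', by simp [hb, hb'], ?_, ?_⟩
  · simp only [map_add, map_mul, ← h1, ← h1']; ring
  · simp only [map_add, map_mul, ← h2, ← h2']; ring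

theorem HasValue.mul (h : HasValue u v r z) (h' : HasValue u v r' z') :
    HasValue u v (r * r') (z * z') := by
  obtain ⟨a, b, hb, h1, h2⟩ := h
  obtain ⟨a', b', hb', h1', h2'⟩ := h'
  refine ⟨a * a', b * b', by simp [hb, hb'], ?_, ?_⟩
  · simp only [map_mul, ← h1, ← h1']; ring
  · simp only [map_mul, ← h2, ← h2']; ring

theorem HasValue.inv (h : HasValue u v r z) (hz : z ≠ 0) : HasValue u v r⁻¹ z⁻¹ := by
  obtain ⟨a, b, hb, h1, h2⟩ := h
  have ha : MvPolynomial.aeval ![u, v] a ≠ 0 := h2 ▸ mul_ne_zero hz hb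
  have hr : r ≠ 0 := by
    rintro rfl
    rw [zero_mul, eq_comm, map_eq_zero_iff _ (IsFractionRing.injective (Poly2 K) (RatFun K))] at h1
    simp [h1] at ha
  refine ⟨b, a, ha, ?_, ?_⟩
  · rw [← h1]; field_simp
  · rw [← h2]; field_simp

theorem HasValue.div (h : HasValue u v r z) (h' : HasValue u v r' z') (hz : z' ≠ 0) :
    HasValue u v (r / r') (z / z') := by
  rw [div_eq_mul_inv, div_eq_mul_inv]
  exact h.mul (h'.inv hz)

theorem HasValue.sub (h : HasValue u v r z) (h' : HasValue u v r' z') :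
    HasValue u v (r - r') (z - z') := by
  have := h.add ((hasValue_const (-1)).mul h')
  simpa [sub_eq_add_neg] using this

theorem HasValue.unique (h : HasValue u v r z) (h' : HasValue u v r z') : z = z' := by
  obtain ⟨a, b, hb, h1, h2⟩ := h
  obtain ⟨a', b', hb', h1', h2'⟩ := h'
  have h3 : a * b' = a' * b := by
    apply IsFractionRing.injective (Poly2 K) (RatFun K)
    rw [map_mul, map_mul, ← h1, ← h1']; ring
  have h4 := congrArg (MvPolynomial.aeval ![u, v]) h3
  rw [map_mul, map_mul, ← h2, ← h2'] at h4
  have h5 := mul_ne_zero hb hb'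
  refine mul_right_cancel₀ h5 ?_
  linear_combination h4

theorem HasValue.mvPolynomial_aeval (h : HasValue u v r z) (h' : HasValue u v r' z')
    (q : Poly2 K) :
    HasValue u v (MvPolynomial.aeval ![r, r'] q) (MvPolynomial.aeval ![z, z'] q) := by
  induction q using MvPolynomial.induction_on with
  | C c => simpa using hasValue_const c
  | add a b ha hb => simpa using ha.add hb
  | mul_X a i ha =>
    rw [map_mul, map_mul, MvPolynomial.aeval_X, MvPolynomial.aeval_X]
    refine ha.mul ?_
    fin_cases i
    · exact h
    · exact h'

theorem HasValue.polynomial_aeval (h : HasValue u v r z) (q : K[X]) :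
    HasValue u v (aeval r q) (aeval z q) := by
  induction q using Polynomial.induction_on' with
  | add a b ha hb => simpa using ha.add hb
  | monomial n c =>
    rw [aeval_monomial, aeval_monomial]
    refine (hasValue_const c).mul ?_
    induction n with
    | zero => simpa using hasValue_const (u := u) (v := v) (1 : K)
    | succ n ih => rw [pow_succ, pow_succ]; exact ih.mul h

theorem mul_algebraMap_den (r : RatFun K) :
    r * algebraMap (Poly2 K) (RatFun K) (IsFractionRing.den (Poly2 K) r) =
      algebraMap (Poly2 K) (RatFun K) (IsFractionRing.num (Poly2 K) r) := by
  have h := IsLocalization.mk'_spec (RatFun K) (IsFractionRing.num (Poly2 K) r)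
    (IsFractionRing.den (Poly2 K) r)
  rwa [IsFractionRing.mk'_num_den] at h

theorem hasValue_of_den_ne_zero
    (h : MvPolynomial.aeval ![u, v] (IsFractionRing.den (Poly2 K) r : Poly2 K) ≠ 0) :
    HasValue u v r (evalRat u v r) := by
  refine ⟨IsFractionRing.num (Poly2 K) r, IsFractionRing.den (Poly2 K) r, h, ?_, ?_⟩
  · exact mul_algebraMap_den r
  · rw [evalRat, div_mul_cancel₀ _ h]

/-- The reduced denominator divides every other denominator of `r`. Thus values computed from
arbitrary fractions, which are stable under field operations, determine `evalRat`. -/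
theorem HasValue.den_ne_zero (h : HasValue u v r z) :
    MvPolynomial.aeval ![u, v] (IsFractionRing.den (Poly2 K) r : Poly2 K) ≠ 0 := by
  obtain ⟨a, b, hb, h1, h2⟩ := h
  have h3 : IsFractionRing.num (Poly2 K) r * b = a * (IsFractionRing.den (Poly2 K) r : Poly2 K) := by
    apply IsFractionRing.injective (Poly2 K) (RatFun K)
    rw [map_mul, map_mul, ← h1, mul_right_comm]
    congr 1
    exact (mul_algebraMap_den r).symm
  have h4 : (IsFractionRing.den (Poly2 K) r : Poly2 K) ∣ b :=
    (IsFractionRing.num_den_reduced (Poly2 K) r).symm.dvd_of_dvd_mul_left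
      (h3 ▸ dvd_mul_left _ _)
  obtain ⟨c, rfl⟩ := h4
  rw [map_mul] at hb
  exact left_ne_zero_of_mul hb

theorem HasValue.evalRat_eq (h : HasValue u v r z) : evalRat u v r = z :=
  (hasValue_of_den_ne_zero h.den_ne_zero).unique h

theorem hasValue_embed (i : Fin 2) (f : RatFunc K)
    (h : aeval (![u, v] i) f.denom ≠ 0) :
    HasValue u v (embed i f) (aeval (![u, v] i) f.num / aeval (![u, v] i) f.denom) := by
  have hX : HasValue u v (algebraMap (Poly2 K) (RatFun K) (MvPolynomial.X i)) (![u, v] i) := by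
    simpa using hasValue_algebraMap (u := u) (v := v) (MvPolynomial.X i : Poly2 K)
  exact (hX.polynomial_aeval f.num).div (hX.polynomial_aeval f.denom) h

theorem hasValue_moebius (A : GL (Fin 2) K) (i : Fin 2)
    (h : algebraMap K L (A.1 1 0) * ![u, v] i + algebraMap K L (A.1 1 1) ≠ 0) :
    HasValue u v (moebius A i) (mobius A (![u, v] i)) := by
  have hX : HasValue u v (algebraMap (Poly2 K) (RatFun K) (MvPolynomial.X i)) (![u, v] i) := by
    simpa using hasValue_algebraMap (u := u) (v := v) (MvPolynomial.X i : Poly2 K)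
  exact (((hasValue_const _).mul hX).add (hasValue_const _)).div
    (((hasValue_const _).mul hX).add (hasValue_const _)) h

/-- Values of transformed rational functions are values at transformed arguments. -/
theorem hasValue_ratComp (A B : GL (Fin 2) K)
    (hA : algebraMap K L (A.1 1 0) * u + algebraMap K L (A.1 1 1) ≠ 0)
    (hB : algebraMap K L (B.1 1 0) * v + algebraMap K L (B.1 1 1) ≠ 0)
    (h : MvPolynomial.aeval ![mobius A u, mobius B v]
      (IsFractionRing.den (Poly2 K) r : Poly2 K) ≠ 0) :
    HasValue u v (ratComp r A B) (evalRat (mobius A u) (mobius B v) r) := by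
  have h0 := hasValue_moebius (u := u) (v := v) A 0 hA
  have h1 := hasValue_moebius (u := u) (v := v) B 1 hB
  exact (h0.mvPolynomial_aeval h1 _).div (h0.mvPolynomial_aeval h1 _) h

theorem aeval_polyComp_eq_zero_iff (p : Poly2 K) (A B : GL (Fin 2) K)
    (hA : algebraMap K L (A.1 1 0) * u + algebraMap K L (A.1 1 1) ≠ 0)
    (hB : algebraMap K L (B.1 1 0) * v + algebraMap K L (B.1 1 1) ≠ 0) :
    MvPolynomial.aeval ![u, v] (polyComp p A B) = 0 ↔
      MvPolynomial.aeval ![mobius A u, mobius B v] p = 0 := by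
  have h := (hasValue_moebius (u := u) (v := v) A 0 hA).mvPolynomial_aeval
    (hasValue_moebius (u := u) (v := v) B 1 hB) p
  have h1 := h.evalRat_eq
  rw [evalRat, div_eq_iff h.den_ne_zero] at h1
  rw [polyComp, h1, mul_eq_zero, or_iff_left h.den_ne_zero]
  rfl

end Evaluation

/-! ### Values of `r` on branches of the curve -/

/-- Two polynomials with a common root, the first one irreducible. -/
theorem _root_.Polynomial.dvd_of_eval₂_eq_zero {R L : Type*} [CommRing R] [IsDomain R]
    [IsGCDMonoid R] [Field L] {φ : R →+* L} (hφ : Function.Injective φ) {P Q : R[X]}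
    (hP : Irreducible P) (hdeg : P.natDegree ≠ 0) {u : L} (h : eval₂ φ u P = 0)
    (hQ : eval₂ φ u Q = 0) : P ∣ Q := by
  classical
  have hprim : P.IsPrimitive := hP.isPrimitive hdeg
  have hPF : Irreducible (P.map (algebraMap R (FractionRing R))) :=
    (IsPrimitive.irreducible_iff_irreducible_map_fraction_map hprim).1 hP
  have hev : ∀ a : R[X], eval₂ (IsFractionRing.lift hφ : FractionRing R →+* L) u
      (a.map (algebraMap R (FractionRing R))) = eval₂ φ u a := by
    intro a
    rw [eval₂_map]
    congr 1
    exact RingHom.ext fun x => IsFractionRing.lift_algebraMap hφ x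
  -- Over the fraction field `P` stays irreducible by Gauss's lemma. Either it divides `Q`, and
  -- primitivity brings the quotient back to `R[X]`, or a Bézout identity evaluated at `u` reads `0
  -- = 1`.
  rcases dvd_or_isCoprime _ (Q.map (algebraMap R (FractionRing R))) hPF with hd | ⟨a, b, hab⟩
  · obtain ⟨g, hg⟩ := hd
    have hl : P.map (algebraMap R (FractionRing R)) * g ∈ lifts (algebraMap R _) := by
      rw [← hg]; exact ⟨Q, rfl⟩
    rw [hprim.map_mul_mem_lifts_iff] at hl
    obtain ⟨g', rfl⟩ := hl
    refine ⟨g', map_injective _ (IsFractionRing.injective R (FractionRing R)) ?_⟩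
    rw [hg, Polynomial.map_mul]
    rfl
  · have := congrArg (eval₂ (IsFractionRing.lift hφ : FractionRing R →+* L) u) hab
    rw [eval₂_add, eval₂_mul, eval₂_mul, hev, hev, h, hQ, mul_zero, mul_zero, add_zero,
      eval₂_one] at this
    exact absurd this zero_ne_one

/-- The kernel of the evaluation at a zero `(u, v)` of an irreducible polynomial `p` is generated
by `p` if `v` is transcendental. -/
theorem dvd_of_aeval_eq_zero {L : Type*} [Field L] [Algebra K L] {p q : Poly2 K}
    (hp : Irreducible p) (hpx : p.degreeOf 0 ≠ 0) {u v : L}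
    (hv : ∀ q : K[X], q ≠ 0 → aeval v q ≠ 0)
    (h : MvPolynomial.aeval ![u, v] p = 0) (hq : MvPolynomial.aeval ![u, v] q = 0) : p ∣ q := by
  -- The polynomials are regarded as polynomials in `x` over `K[y]`, which embeds in `L` because `v`
  -- is transcendental.
  let φ : MvPolynomial (Fin 1) K →ₐ[K] L := MvPolynomial.aeval (fun _ => v)
  have hφ : Function.Injective (φ : MvPolynomial (Fin 1) K →+* L) := by
    rw [injective_iff_map_eq_zero]
    intro a ha
    by_contra ha0
    refine hv (MvPolynomial.uniqueAlgEquiv K (Fin 1) a)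
      ((map_ne_zero_iff _ (MvPolynomial.uniqueAlgEquiv K (Fin 1)).injective).2 ha0) ?_
    rw [← ha]
    have h1 : (aeval v).comp (MvPolynomial.uniqueAlgEquiv K (Fin 1)).toAlgHom = φ := by
      ext i; simp [φ]
    exact DFunLike.congr_fun h1 a
  have hev : ∀ a : Poly2 K, eval₂ (φ : MvPolynomial (Fin 1) K →+* L) u
      (MvPolynomial.finSuccEquiv K 1 a) = MvPolynomial.aeval ![u, v] a := by
    intro a
    induction a using MvPolynomial.induction_on with
    | C c => simp [φ, MvPolynomial.finSuccEquiv_apply]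
    | add a b ha hb => simp only [map_add, eval₂_add, ha, hb]
    | mul_X a i ha =>
      rw [map_mul, eval₂_mul, ha, map_mul]
      congr 1
      refine Fin.cases ?_ (fun j => ?_) i
      · simp [MvPolynomial.finSuccEquiv_X_zero]
      · rw [MvPolynomial.finSuccEquiv_X_succ]
        fin_cases j
        simp [φ]
  obtain ⟨g, hg⟩ := dvd_of_eval₂_eq_zero hφ
    ((MulEquiv.irreducible_iff (MvPolynomial.finSuccEquiv K 1)).2 hp)
    (by rwa [MvPolynomial.natDegree_finSuccEquiv]) ((hev p).trans h) ((hev q).trans hq)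
  refine ⟨(MvPolynomial.finSuccEquiv K 1).symm g, (MvPolynomial.finSuccEquiv K 1).injective ?_⟩
  rw [map_mul, AlgEquiv.apply_symm_apply, hg]

/-- On the curve, `r` has the value `f - g`. -/
theorem hasValue_sub_of_mem_sepSet {p : Poly2 K} (hp : Irreducible p) (hpx : p.degreeOf 0 ≠ 0)
    {r : RatFun K} {f g : RatFunc K} (hfg : (f, g) ∈ sepSet r p)
    {s : Pt K} {u v : HahnSeries ℚ K} (hu : Near s.1 u) (hv : Near s.2 v)
    (h : MvPolynomial.aeval ![u, v] p = 0) :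
    HasValue u v r (f.eval (algebraMap K (HahnSeries ℚ K)) u -
      g.eval (algebraMap K (HahnSeries ℚ K)) v) := by
  have hloc : ∀ q ∈ localRing p, HasValue u v q (evalRat u v q) := fun q hq =>
    hasValue_of_den_ne_zero fun h0 =>
      hq (dvd_of_aeval_eq_zero hp hpx (fun _ => hv.aeval_ne_zero) h h0)
  obtain ⟨q, hq, hqe⟩ := hfg
  have h0 : HasValue u v (embed 0 f - embed 1 g - r) 0 := by
    rw [hqe]
    have := (hloc q hq).mul (hasValue_algebraMap (u := u) (v := v) p)
    rwa [h, mul_zero] at this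
  have hf := hasValue_embed (u := u) (v := v) 0 f (hu.aeval_ne_zero f.denom_ne_zero)
  have hg := hasValue_embed (u := u) (v := v) 1 g (hv.aeval_ne_zero g.denom_ne_zero)
  have := (hf.sub hg).sub h0
  rw [sub_sub_cancel, sub_zero] at this
  exact this

/-- The data of a pole at infinity after a transformation, in terms of the original curve. -/
theorem evalRat_ratComp {p : Poly2 K} (hp : Irreducible p) (hpx : p.degreeOf 0 ≠ 0)
    {r : RatFun K} {f g : RatFunc K} (hfg : (f, g) ∈ sepSet r p)
    {s : Pt K} (A B : GL (Fin 2) K) {u v : HahnSeries ℚ K} (hu : u.order < 0) (hv : v.order < 0)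
    (hs : Near s.1 (mobius A u)) (ht : Near s.2 (mobius B v))
    (h : MvPolynomial.aeval ![u, v] (polyComp p A B) = 0) :
    evalRat u v (ratComp r A B) = f.eval (algebraMap K (HahnSeries ℚ K)) (mobius A u) -
      g.eval (algebraMap K (HahnSeries ℚ K)) (mobius B v) := by
  have hA := mobius_denominator_ne_zero A hu
  have hB := mobius_denominator_ne_zero B hv
  rw [aeval_polyComp_eq_zero_iff p A B hA hB] at h
  have hval := hasValue_sub_of_mem_sepSet hp hpx hfg hs ht h
  rw [(hasValue_ratComp A B hA hB hval.den_ne_zero).evalRat_eq, hval.evalRat_eq]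

theorem order_serX_neg : (serX K).order < 0 := by
  rw [serX, HahnSeries.order_single one_ne_zero]; norm_num

/-- At a pole of `r`, one of `f` and `g` has a pole. -/
theorem IsPole.isUnivPole_or {p : Poly2 K} (hp : Irreducible p) (hpx : p.degreeOf 0 ≠ 0)
    {r : RatFun K} {f g : RatFunc K} (hfg : (f, g) ∈ sepSet r p)
    {s : Pt K} (h : IsPole r p s) : IsUnivPole f s.1 ∨ IsUnivPole g s.2 := by
  classical
  obtain ⟨-, A, B, hA, hB, -, φ, -, h0, hφ, hpos⟩ := h
  have hφ' : φ.order < 0 := by simpa [serDeg] using hφ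
  -- The inverse transformation carries the branch at `(∞, ∞)` to a branch at `s`, where `r` has the
  -- value `f - g`.
  have hs := near_mobius A⁻¹ (order_serX_neg (K := K))
  have ht := near_mobius B⁻¹ hφ'
  rw [← hA, inv_smul_smul] at hs
  rw [← hB, inv_smul_smul] at ht
  rw [evalRat_ratComp hp hpx hfg A⁻¹ B⁻¹ order_serX_neg hφ' hs ht h0] at hpos
  rw [← hs.serDeg_pos_iff, ← ht.serDeg_pos_iff]
  exact min_serDeg_le hpos

/-! ### The curve -/

section HEval

variable {R S : Type*} [CommRing R] [Algebra K R] [CommRing S] [Algebra K S]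

/-- The value of the bi-homogenization of `p` at a pair of homogeneous coordinates. -/
def hEval (p : Poly2 K) (w : Fin 2 → Fin 2 → R) : R :=
  ∑ m ∈ p.support, algebraMap K R (p.coeff m) *
    ∏ j, (w j 0 ^ (p.degreeOf j - m j) * w j 1 ^ m j)

theorem mem_curve_iff {p : Poly2 K} {s : Pt K} :
    s ∈ curve p ↔ hEval p ![coords s.1, coords s.2] = 0 := by
  have : MvPolynomial.eval (Sum.elim (coords s.1) (coords s.2)) (biHom p) =
      hEval p ![coords s.1, coords s.2] := by
    simp [biHom, hEval, Fin.prod_univ_two, mul_assoc]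
  rw [← this]
  rfl

theorem map_hEval (h : R →ₐ[K] S) (p : Poly2 K) (w : Fin 2 → Fin 2 → R) :
    h (hEval p w) = hEval p fun j k => h (w j k) := by
  simp [hEval]

theorem hEval_smul (p : Poly2 K) (c : Fin 2 → R) (w : Fin 2 → Fin 2 → R) :
    hEval p (fun j k => c j * w j k) = (∏ j, c j ^ p.degreeOf j) * hEval p w := by
  rw [hEval, hEval, Finset.mul_sum]
  refine Finset.sum_congr rfl fun m hm => ?_
  rw [mul_left_comm, ← Finset.prod_mul_distrib]
  congr 1
  refine Finset.prod_congr rfl fun j _ => ?_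
  have hmj : m j ≤ p.degreeOf j := MvPolynomial.monomial_le_degreeOf j hm
  conv_rhs => rw [← Nat.sub_add_cancel hmj, pow_add]
  rw [Nat.add_sub_cancel, mul_pow, mul_pow]
  ring

theorem hEval_eq_aeval (p : Poly2 K) (w : Fin 2 → Fin 2 → R) (h : ∀ j, w j 0 = 1) :
    hEval p w = MvPolynomial.aeval (fun j => w j 1) p := by
  simp [hEval, MvPolynomial.aeval_def, MvPolynomial.eval₂_eq', h]

theorem hEval_eq_zero_iff_aeval {L : Type*} [Field L] [Algebra K L] (p : Poly2 K)
    (w : Fin 2 → Fin 2 → L) (h : ∀ j, w j 0 ≠ 0) :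
    hEval p w = 0 ↔ MvPolynomial.aeval (fun j => w j 1 / w j 0) p = 0 := by
  have h1 : w = fun j k => w j 0 * (![1, w j 1 / w j 0] : Fin 2 → L) k := by
    ext j k
    fin_cases k
    · simp
    · simp [mul_div_cancel₀ _ (h j)]
  conv_lhs => rw [h1, hEval_smul]
  rw [mul_eq_zero, or_iff_right (Finset.prod_ne_zero_iff.2 fun j _ => pow_ne_zero _ (h j)),
    hEval_eq_aeval _ _ (fun _ => rfl)]
  rfl

/-- Homogeneous coordinates of a point close to `s`. -/
def chart (s : OnePoint K) (z : R) : Fin 2 → R :=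
  match s with
  | ∞ => ![z, 1]
  | (a : K) => ![1, algebraMap K R a + z]

theorem chart_infty (z : R) : chart (∞ : OnePoint K) z = ![z, 1] := rfl

theorem chart_coe (a : K) (z : R) : chart (a : OnePoint K) z = ![1, algebraMap K R a + z] := rfl

theorem map_chart (h : R →ₐ[K] S) (s : OnePoint K) (z : R) (k : Fin 2) :
    h (chart s z k) = chart s (h z) k := by
  induction s using OnePoint.rec <;> fin_cases k <;> simp [chart_infty, chart_coe]

theorem chart_zero (s : OnePoint K) (k : Fin 2) :
    chart s (0 : R) k = algebraMap K R (coords s k) := by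
  induction s using OnePoint.rec <;> fin_cases k <;> simp [chart_infty, chart_coe, coords]

theorem map_hEval_chart (h : R →ₐ[K] S) (p : Poly2 K) (s : Pt K) (y z : R) :
    h (hEval p ![chart s.1 y, chart s.2 z]) = hEval p ![chart s.1 (h y), chart s.2 (h z)] := by
  rw [map_hEval]
  congr 1
  ext j k
  fin_cases j <;> simp [map_chart]

end HEval

/-- Modulo `X i - a`, substituting `a` for `X i` does not change `p`. -/
theorem sub_dvd_of_aeval_eq_zero (p : Poly2 K) (i : Fin 2) (a : K)
    (h : MvPolynomial.aeval (fun k => if k = i then C a else (X : K[X])) p = 0) :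
    (MvPolynomial.X i - MvPolynomial.C a : Poly2 K) ∣ p := by
  have h1 : MvPolynomial.aeval (fun k => if k = i then MvPolynomial.C a
      else (MvPolynomial.X k : Poly2 K)) p = 0 := by
    have := congrArg (aeval (MvPolynomial.X (Fin.rev i) : Poly2 K)) h
    rw [map_zero, MvPolynomial.comp_aeval_apply] at this
    rw [← this]
    congr 2
    ext1 k
    by_cases hk : k = i
    · simp [hk, MvPolynomial.algebraMap_eq]
    · have : k = Fin.rev i := by
        fin_cases k <;> fin_cases i <;> simp_all
      simp [hk, ← this]
  rw [← Ideal.mem_span_singleton, ← Ideal.Quotient.eq_zero_iff_mem]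
  set I : Ideal (Poly2 K) := Ideal.span {MvPolynomial.X i - MvPolynomial.C a}
  have h2 : (Ideal.Quotient.mkₐ K I).comp (MvPolynomial.aeval (fun k => if k = i then
      MvPolynomial.C a else (MvPolynomial.X k : Poly2 K))) = Ideal.Quotient.mkₐ K I := by
    apply MvPolynomial.algHom_ext
    intro k
    by_cases hk : k = i
    · subst hk
      simp only [AlgHom.comp_apply, MvPolynomial.aeval_X, if_true, Ideal.Quotient.mkₐ_eq_mk]
      rw [eq_comm, Ideal.Quotient.eq]
      exact Ideal.mem_span_singleton_self _
    · simp [hk]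
  have h3 := DFunLike.congr_fun h2 p
  rw [AlgHom.comp_apply, h1, map_zero] at h3
  exact h3.symm

/-- The restriction of the bi-homogenization of `p` to a line of `P¹ × P¹` is not zero. -/
theorem hEval_line_ne_zero {p : Poly2 K} (hp : Irreducible p) (i : Fin 2)
    (hdeg : ∀ j ≠ i, p.degreeOf j ≠ 0) (c : OnePoint K) :
    hEval p (fun k => if k = i then fun l => C (coords c l) else ![1, (X : K[X])]) ≠ 0 := by
  classical
  have hij : Fin.rev i ≠ i := by fin_cases i <;> simp
  induction c using OnePoint.rec with
  | coe a =>
    intro h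
    rw [hEval_eq_aeval _ _ (fun j => by by_cases hj : j = i <;> simp [hj, coords])] at h
    -- By irreducibility, `p` would be a constant multiple of `X i - a` and so have degree 0 in the
    -- other variable.
    obtain ⟨q, hq⟩ := sub_dvd_of_aeval_eq_zero p i a (by
      rw [← h]
      congr 2
      ext1 k
      by_cases hk : k = i <;> simp [hk, coords])
    rcases hp.isUnit_or_isUnit hq with hu | hu
    · have := hu.map (MvPolynomial.eval fun _ => a)
      simp at this
    · obtain ⟨b, -, rfl⟩ := MvPolynomial.isUnit_iff_eq_C_of_isReduced.1 hu
      refine hdeg _ hij ?_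
      rw [hq, mul_comm, ← Nat.le_zero]
      refine (MvPolynomial.degreeOf_C_mul_le _ _ _).trans ?_
      refine (MvPolynomial.degreeOf_sub_le _ _ _).trans ?_
      simp [MvPolynomial.degreeOf_X, hij]
  | infty =>
    -- At `∞` only the monomials of top degree in variable `i` survive; the coefficient of `M`
    -- remains visible.
    obtain ⟨M, hM, hMi⟩ : ∃ M ∈ p.support, M i = p.degreeOf i := by
      rw [MvPolynomial.degreeOf_eq_sup]
      obtain ⟨M, hM, h⟩ := Finset.exists_mem_eq_sup p.support
        (MvPolynomial.support_nonempty.2 hp.ne_zero) (fun m => m i)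
      exact ⟨M, hM, h.symm⟩
    intro h
    have h1 := congrArg (fun q => coeff q (M (Fin.rev i))) h
    have hterm : ∀ m ∈ p.support, (algebraMap K K[X] (p.coeff m) *
        ∏ j, ((fun k => if k = i then fun l => C (coords (∞ : OnePoint K) l)
          else ![1, (X : K[X])]) j 0 ^ (p.degreeOf j - m j) *
        (fun k => if k = i then fun l => C (coords (∞ : OnePoint K) l)
          else ![1, (X : K[X])]) j 1 ^ m j)).coeff (M (Fin.rev i)) =
        if m = M then p.coeff M else 0 := by
      intro m hm
      have hmi : m i ≤ p.degreeOf i := MvPolynomial.monomial_le_degreeOf i hm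
      have hprod : ∀ F : Fin 2 → K[X], ∏ j, F j = F i * F (Fin.rev i) := by
        intro F
        rw [Fin.prod_univ_two]
        fin_cases i
        · rfl
        · exact mul_comm _ _
      rw [hprod]
      simp only [if_true, if_neg hij, coords, Matrix.cons_val_zero, Matrix.cons_val_one, C_0, C_1,
        one_pow, mul_one, one_mul, algebraMap_eq]
      by_cases hmM : m = M
      · subst hmM
        simp [hMi]
      · rw [if_neg hmM]
        by_cases hd : p.degreeOf i - m i = 0
        · rw [hd, pow_zero, one_mul, coeff_C_mul, coeff_X_pow, if_neg, mul_zero]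
          intro heq
          apply hmM
          ext k
          by_cases hk : k = i
          · subst hk; omega
          · have : k = Fin.rev i := by
              fin_cases k <;> fin_cases i <;> simp_all
            rw [this, heq]
        · rw [zero_pow hd]; simp
    simp only [hEval, finsetSum_coeff, coeff_zero] at h1
    rw [Finset.sum_congr rfl hterm, Finset.sum_ite_eq' p.support M, if_pos hM] at h1
    exact MvPolynomial.mem_support_iff.1 hM h1

theorem finite_hEval_line {p : Poly2 K} (hp : Irreducible p) (i : Fin 2)
    (hdeg : ∀ j ≠ i, p.degreeOf j ≠ 0) (c : OnePoint K) :
    {b : K | hEval p (fun k => if k = i then coords c else ![1, b]) = 0}.Finite := by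
  classical
  refine ((hEval p (fun k => if k = i then fun l => C (coords c l)
    else ![1, (X : K[X])])).roots.toFinset.finite_toSet).subset fun b hb => ?_
  rw [Finset.mem_coe, Multiset.mem_toFinset, mem_roots (hEval_line_ne_zero hp i hdeg c), IsRoot.def,
    ← coe_aeval_eq_eval, ← AlgHom.coe_toRingHom, RingHom.coe_coe, map_hEval, ← hb]
  congr 1
  ext k l
  by_cases hk : k = i
  · simp [hk]
  · fin_cases l <;> simp [hk]

theorem finite_curve_line {p : Poly2 K} (hp : Irreducible p) (i : Fin 2)
    (hdeg : ∀ j ≠ i, p.degreeOf j ≠ 0) (c : OnePoint K) :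
    {t : OnePoint K | hEval p (fun k => if k = i then coords c else coords t) = 0}.Finite := by
  refine (((finite_hEval_line hp i hdeg c).image ((↑) : K → OnePoint K)).insert ∞).subset
    fun t ht => ?_
  induction t using OnePoint.rec with
  | infty => exact Set.mem_insert _ _
  | coe b => exact Set.mem_insert_of_mem _ ⟨b, ht, rfl⟩

/-- Otherwise every value of the chart parameter would give a point of the curve on one line, hence
infinitely many affine ones. In the chart at `∞` the coordinates `(z⁻¹ : 1)` are rescaled to `(1 :
z)`. -/
theorem hEval_chart_ne_zero [Infinite K] {p : Poly2 K} (hp : Irreducible p) (i : Fin 2)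
    (hdeg : ∀ j ≠ i, p.degreeOf j ≠ 0) (c t : OnePoint K) :
    hEval p (fun k => if k = i then chart c 0 else chart t (X : K[X])) ≠ 0 := by
  intro h
  have h1 : ∀ z : K, hEval p (fun k => if k = i then coords c else chart t z) = 0 := by
    intro z
    have h2 := congrArg (aeval z) h
    rw [map_hEval, map_zero] at h2
    rw [← h2]
    congr 1
    ext k l
    by_cases hk : k = i
    · simp [hk, chart_zero]
    · simp [hk, map_chart]
  have hfin := finite_hEval_line hp i hdeg c
  induction t using OnePoint.rec with
  | coe b =>
    refine hfin.not_infinite (Set.infinite_univ.mono fun z _ => ?_)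
    have := h1 (z - b)
    simpa [chart_coe] using this
  | infty =>
    refine hfin.not_infinite ((Set.finite_singleton (0 : K)).infinite_compl.mono fun z hz => ?_)
    have hz' : z ≠ 0 := hz
    have h2 := h1 z⁻¹
    have h3 : (fun k => if k = i then coords c else chart (∞ : OnePoint K) z⁻¹) =
        fun j k => (if j = i then 1 else z⁻¹) *
          (fun k => if k = i then coords c else ![1, z]) j k := by
      ext k l
      by_cases hk : k = i
      · simp [hk]
      · fin_cases l <;> simp [hk, chart_infty, hz']
    rw [h3, hEval_smul, mul_eq_zero, or_iff_right] at h2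
    · exact h2
    · refine Finset.prod_ne_zero_iff.2 fun j _ => pow_ne_zero _ ?_
      split_ifs
      · exact one_ne_zero
      · exact inv_ne_zero hz'

/-! ### Branches through given points, and the poles they produce -/

/-- The constant coefficient, as a homomorphism of algebras. -/
def constantCoeffHom (K : Type*) [Field K] : PowerSeries K →ₐ[K] K :=
  { PowerSeries.constantCoeff (R := K) with
    commutes' := fun c => by simp }

theorem constantCoeffHom_apply (ψ : PowerSeries K) :
    constantCoeffHom K ψ = PowerSeries.constantCoeff ψ := rfl

/-- Through every point of the curve there is a branch of it, parametrized by a Puiseux series. -/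
theorem exists_branch [IsAlgClosed K] [CharZero K] {p : Poly2 K} (hp : Irreducible p)
    (hpx : p.degreeOf 0 ≠ 0) (hpy : p.degreeOf 1 ≠ 0) {s : Pt K} (hs : s ∈ curve p) :
    ∃ φ : HahnSeries ℚ K, IsPuiseux φ ∧ φ.order < 0 ∧
      hEval p ![chart s.1 (serX K)⁻¹, chart s.2 φ⁻¹] = 0 := by
  have hx : ∀ j : Fin 2, j ≠ 1 → p.degreeOf j ≠ 0 := by
    intro j hj; fin_cases j <;> simp_all
  have hy : ∀ j : Fin 2, j ≠ 0 → p.degreeOf j ≠ 0 := by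
    intro j hj; fin_cases j <;> simp_all
  have hline0 : ∀ {R : Type _} (a b : Fin 2 → R), (fun k : Fin 2 => if k = 0 then a else b) = ![a, b] := by
    intro R a b; ext k; fin_cases k <;> simp
  have hline1 : ∀ {R : Type _} (a b : Fin 2 → R), (fun k : Fin 2 => if k = 1 then b else a) = ![a, b] := by
    intro R a b; ext k; fin_cases k <;> simp
  -- `Q` is the local equation of the curve at `s`: the power series variable is the local parameter
  -- in the first coordinate, the polynomial variable that in the second.
  set Q : Polynomial (PowerSeries K) := hEval p ![chart s.1 (C PowerSeries.X), chart s.2 X] with hQ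
  have hred : Q.map PowerSeries.constantCoeff = hEval p ![chart s.1 0, chart s.2 (X : K[X])] := by
    have := map_hEval_chart (mapAlgHom (constantCoeffHom K)) p s (C PowerSeries.X) X
    rw [← hQ] at this
    have h2 : Q.map PowerSeries.constantCoeff = mapAlgHom (constantCoeffHom K) Q := rfl
    rw [h2, this]
    congr 4
    · simp [constantCoeffHom_apply]
    · simp
  have hne : Q.map PowerSeries.constantCoeff ≠ 0 := by
    rw [hred]
    have := hEval_chart_ne_zero hp 0 hy s.1 s.2
    rwa [hline0] at this
  have h0 : (Q.map PowerSeries.constantCoeff).coeff 0 = 0 := by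
    rw [coeff_zero_eq_eval_zero, ← coe_aeval_eq_eval, ← AlgHom.coe_toRingHom, RingHom.coe_coe, hred,
      map_hEval_chart, map_zero, aeval_X]
    rw [mem_curve_iff] at hs
    refine Eq.trans ?_ hs
    congr 1
    ext j k
    fin_cases j <;> simp [chart_zero]
  obtain ⟨N, hN, ψ, hψ0, hψ⟩ := exists_puiseux_root (Q.map PowerSeries.constantCoeff).natTrailingDegree
    Q (Nat.pos_of_ne_zero fun h => (natTrailingDegree_eq_zero.1 h).elim hne (fun h => h h0))
    (fun i hi => by rw [← coeff_map]; exact coeff_eq_zero_of_lt_natTrailingDegree hi)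
    (by rw [← coeff_map]; exact trailingCoeff_nonzero_iff_nonzero.2 hne)
  have hev : hEval p ![chart s.1 (PowerSeries.X ^ N), chart s.2 ψ] = 0 := by
    have := map_hEval_chart (((aeval ψ).restrictScalars K).comp
      (mapAlgHom (PowerSeries.expand (R := K) N hN))) p s (C PowerSeries.X) X
    rw [← hQ] at this
    have h2 : ((aeval ψ).restrictScalars K).comp
        (mapAlgHom (PowerSeries.expand (R := K) N hN)) Q = Q.eval₂ (expandHom K N hN) ψ := by
      rw [eval₂_eq_eval_map, ← coe_aeval_eq_eval]
      rfl
    rw [h2, hψ] at this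
    rw [this]
    congr 4 <;> simp
  have hX : (serX K)⁻¹ = HahnSeries.single 1 1 := by
    refine inv_eq_of_mul_eq_one_left ?_
    rw [serX, HahnSeries.single_mul_single]
    simp
  have hL := congrArg (powerSeriesHom K N hN) hev
  rw [map_hEval_chart, map_zero, powerSeriesHom_X_pow, ← hX] at hL
  -- If the second parameter vanished identically, the curve would contain a line with constant
  -- second coordinate. Nonvanishing is needed because `φ` is its inverse.
  have hz : powerSeriesHom K N hN ψ ≠ 0 := by
    intro hz
    rw [hz] at hL
    have hne' := hEval_chart_ne_zero hp 1 hx s.2 s.1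
    rw [hline1] at hne'
    have hpos : 0 < ((serX K)⁻¹).order := by
      rw [hX, HahnSeries.order_single one_ne_zero]; norm_num
    refine (order_aeval_of_order_pos hpos _ _ hne' rfl).1 ?_
    rw [map_hEval_chart, map_zero, aeval_X, hL]
  refine ⟨(powerSeriesHom K N hN ψ)⁻¹, isPuiseux_inv_powerSeriesHom N hN ψ, ?_, ?_⟩
  · rw [order_inv', neg_lt_zero]
    exact order_powerSeriesHom_pos N hN ψ hψ0 hz
  · rwa [inv_inv]

/-- A branch of the curve that goes to infinity in both coordinates passes through `(∞, ∞)`. -/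
theorem infty_mem_curve (p : Poly2 K) {x φ : HahnSeries ℚ K} (hx : x.order < 0) (hφ : φ.order < 0)
    (h : MvPolynomial.aeval ![x, φ] p = 0) : ((∞, ∞) : Pt K) ∈ curve p := by
  have hx0 : x ≠ 0 := by rintro rfl; simp at hx
  have hφ0 : φ ≠ 0 := by rintro rfl; simp at hφ
  have h1 : hEval p ![![x⁻¹, 1], ![φ⁻¹, 1]] = 0 := by
    rw [hEval_eq_zero_iff_aeval _ _ (fun j => by fin_cases j <;> simp [hx0, hφ0]), ← h]
    congr 2
    ext1 j
    fin_cases j <;> simp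
  rw [mem_curve_iff]
  -- Since `x⁻¹` and `φ⁻¹` have positive order, taking the coefficient at exponent 0 amounts to
  -- replacing both by 0, that is, to evaluating at `(∞, ∞)`.
  have h2 := congrArg (fun z => HahnSeries.coeff z (0 : ℚ)) h1
  simp only [hEval, HahnSeries.coeff_sum, HahnSeries.coeff_zero] at h2
  rw [hEval, ← h2]
  refine Finset.sum_congr rfl fun m _ => ?_
  simp only [Fin.prod_univ_two, coords, Matrix.cons_val_zero, Matrix.cons_val_one, one_pow, mul_one,
    Algebra.algebraMap_self, RingHom.id_apply]
  set a := p.degreeOf 0 - m 0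
  set b := p.degreeOf 1 - m 1
  rw [algebraMap_hahnSeries, HahnSeries.C_apply, HahnSeries.coeff_single_zero_mul]
  congr 1
  have hxo : 0 < (x⁻¹).order := by rw [order_inv']; linarith
  have hφo : 0 < (φ⁻¹).order := by rw [order_inv']; linarith
  by_cases hab : a = 0 ∧ b = 0
  · simp [hab.1, hab.2]
  · have h3 : (0 : K) ^ a * 0 ^ b = 0 := by
      rcases not_and_or.1 hab with h | h <;> simp [h]
    rw [h3, eq_comm]
    apply HahnSeries.coeff_eq_zero_of_lt_order
    rw [HahnSeries.order_mul (pow_ne_zero _ (inv_ne_zero hx0)) (pow_ne_zero _ (inv_ne_zero hφ0)),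
      HahnSeries.order_pow, HahnSeries.order_pow, nsmul_eq_mul, nsmul_eq_mul]
    rcases not_and_or.1 hab with h | h
    · have : (0 : ℚ) < a := by exact_mod_cast Nat.pos_of_ne_zero h
      positivity
    · have : (0 : ℚ) < b := by exact_mod_cast Nat.pos_of_ne_zero h
      positivity

-- For finite `a` the matrix `(a 1; 1 0)` is the map `w ↦ a + w⁻¹`. This translates branches in
-- charts into the transformations used to define poles.
open Classical in
theorem exists_mobius_eq_chart (s : OnePoint K) :
    ∃ G : GL (Fin 2) K, G • (∞ : OnePoint K) = s ∧ ∀ w : HahnSeries ℚ K, w ≠ 0 →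
      chart s w⁻¹ 0 ≠ 0 ∧ mobius G w = chart s w⁻¹ 1 / chart s w⁻¹ 0 := by
  induction s using OnePoint.rec with
  | infty =>
    refine ⟨1, one_smul _ _, fun w hw => ⟨?_, ?_⟩⟩
    · simpa [chart_infty] using hw
    · simp [chart_infty, mobius]
  | coe a =>
    refine ⟨Matrix.GeneralLinearGroup.mkOfDetNeZero !![a, 1; 1, 0] (by simp), ?_,
      fun w hw => ⟨?_, ?_⟩⟩
    · rw [OnePoint.smul_infty_eq_ite]
      simp [Matrix.GeneralLinearGroup.mkOfDetNeZero]
    · simp [chart_coe]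
    · simp [chart_coe, mobius, Matrix.GeneralLinearGroup.mkOfDetNeZero]
      field_simp

/-- A point of the curve at which exactly one of `f` and `g` has a pole is a pole of `r`. -/
theorem isPole_of_isUnivPole [IsAlgClosed K] [CharZero K] {p : Poly2 K} (hp : Irreducible p)
    (hpx : p.degreeOf 0 ≠ 0) (hpy : p.degreeOf 1 ≠ 0) {r : RatFun K} {f g : RatFunc K}
    (hfg : (f, g) ∈ sepSet r p) {s : Pt K} (hs : s ∈ curve p)
    (h : ¬ (IsUnivPole f s.1 ↔ IsUnivPole g s.2)) : IsPole r p s := by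
  classical
  obtain ⟨φ, hφ, hφ', h0⟩ := exists_branch hp hpx hpy hs
  obtain ⟨G, hG, hG'⟩ := exists_mobius_eq_chart s.1
  obtain ⟨H, hH, hH'⟩ := exists_mobius_eq_chart s.2
  have hx := order_serX_neg (K := K)
  have hx0 : serX K ≠ 0 := by intro h; simp [h] at hx
  have hφ0 : φ ≠ 0 := by rintro rfl; simp at hφ'
  obtain ⟨hG1, hG2⟩ := hG' _ hx0
  obtain ⟨hH1, hH2⟩ := hH' _ hφ0
  have hzero : MvPolynomial.aeval ![serX K, φ] (polyComp p G H) = 0 := by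
    rw [aeval_polyComp_eq_zero_iff p G H (mobius_denominator_ne_zero G hx)
      (mobius_denominator_ne_zero H hφ')]
    have hne : ∀ j : Fin 2, (![chart s.1 (serX K)⁻¹, chart s.2 φ⁻¹] : Fin 2 → Fin 2 → _) j 0 ≠ 0 :=
      Fin.forall_fin_two.2 ⟨hG1, hH1⟩
    have hvec : ![mobius G (serX K), mobius H φ] = fun j : Fin 2 =>
        (![chart s.1 (serX K)⁻¹, chart s.2 φ⁻¹] : Fin 2 → Fin 2 → _) j 1 /
          (![chart s.1 (serX K)⁻¹, chart s.2 φ⁻¹] : Fin 2 → Fin 2 → _) j 0 := by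
      rw [hG2, hH2]
      exact funext (Fin.forall_fin_two.2 ⟨rfl, rfl⟩)
    rw [hvec]
    exact (hEval_eq_zero_iff_aeval p _ hne).1 h0
  have hn1 := near_mobius G hx
  have hn2 := near_mobius H hφ'
  rw [hG] at hn1
  rw [hH] at hn2
  refine ⟨hs, G⁻¹, H⁻¹, by rw [← hG, inv_smul_smul], by rw [← hH, inv_smul_smul], ?_⟩
  rw [inv_inv, inv_inv]
  refine ⟨infty_mem_curve _ hx hφ' hzero, φ, hφ, hzero, by simpa [serDeg] using hφ', ?_⟩
  rw [evalRat_ratComp hp hpx hfg G H hx hφ' hn1 hn2 hzero]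
  rw [← hn1.serDeg_pos_iff, ← hn2.serDeg_pos_iff] at h
  have hneg : ∀ a : HahnSeries ℚ K, serDeg (-a) = serDeg a := fun a => by
    rw [serDeg, serDeg, HahnSeries.order_neg]
  -- Exactly one of the two terms has positive degree, so the difference keeps it.
  by_cases hf : 0 < serDeg (f.eval (algebraMap K (HahnSeries ℚ K)) (mobius G (serX K)))
  · rw [sub_eq_add_neg]
    exact serDeg_add_pos hf (by rw [hneg]; exact fun hg => h ⟨fun _ => hg, fun _ => hf⟩)
  · rw [sub_eq_neg_add]
    refine serDeg_add_pos ?_ hf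
    rw [hneg]
    by_contra hg
    exact h ⟨fun h1 => absurd h1 hf, fun h1 => absurd h1 hg⟩

/-! ### Graphs -/

section Graph

variable {V : Type*} {G : SimpleGraph V}

theorem IsInfCycleFreePath.tail {v : ℕ → V} (h : IsInfCycleFreePath G v) (n : ℕ) :
    IsInfCycleFreePath G fun i => v (n + i) :=
  ⟨fun i => h.1 (n + i), fun i j hij => h.2 _ _ (by omega)⟩

theorem IsInfCycleFreePath.injective {v : ℕ → V} (h : IsInfCycleFreePath G v) :
    Function.Injective v := by
  intro i j hij
  rcases lt_trichotomy i j with h' | h' | h'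
  · exact absurd hij (h.2 i j h')
  · exact h'
  · exact absurd hij.symm (h.2 j i h')

/-- An infinite connected component of a locally finite graph contains an infinite path. -/
theorem exists_infinite_path (hfin : ∀ v, (G.neighborSet v).Finite) (v : V)
    (hv : {w | G.Reachable v w}.Infinite) :
    ∃ w : ℕ → V, IsInfCycleFreePath G w ∧ w 0 = v := by
  -- `D u` consists of the vertices that some geodesic from `v` reaches through `u`. If it is
  -- infinite, so is `D u'` for one of the finitely many neighbours `u'` of `u` that are one step
  -- farther from `v`.
  let D : V → Set V := fun u => {w | G.Reachable u w ∧ G.dist v w = G.dist v u + G.dist u w}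
  let T := {u : V // G.Reachable v u ∧ (D u).Infinite}
  have hstep : ∀ u : T, ∃ u' : T, G.Adj u.1 u'.1 ∧ G.dist v u'.1 = G.dist v u.1 + 1 := by
    rintro ⟨u, hvu, hu⟩
    by_contra! H
    refine hu (((hfin u).biUnion (t := fun u' => {w | w ∈ D u' ∧ G.Reachable v u' ∧
      G.dist v u' = G.dist v u + 1}) fun u' hu' => ?_).insert u |>.subset fun w hw => ?_)
    · by_contra hinf
      obtain ⟨w, -, h1, h2⟩ := Set.Infinite.nonempty hinf
      exact H ⟨u', h1, Set.Infinite.mono (fun _ h => h.1) hinf⟩ hu' h2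
    · rcases eq_or_ne w u with rfl | hwu
      · exact Set.mem_insert _ _
      · refine Set.mem_insert_of_mem _ ?_
        obtain ⟨hr, hd⟩ := hw
        obtain ⟨q, hq⟩ := hr.exists_walk_length_eq_dist
        cases q with
        | nil => exact absurd rfl hwu
        | @cons _ u' _ hadj q' =>
          rw [SimpleGraph.Walk.length_cons] at hq
          have h1 : G.dist u' w ≤ q'.length := SimpleGraph.dist_le q'
          have hvu' : G.Reachable v u' := hvu.trans hadj.reachable
          obtain ⟨a, ha⟩ := hvu.exists_walk_length_eq_dist
          have h2 : G.dist v u' ≤ G.dist v u + 1 := by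
            have := SimpleGraph.dist_le (a.concat hadj)
            rwa [SimpleGraph.Walk.length_concat, ha] at this
          obtain ⟨b, hb⟩ := hvu'.exists_walk_length_eq_dist
          obtain ⟨c, hc⟩ := (q'.reachable).exists_walk_length_eq_dist
          have h3 : G.dist v w ≤ G.dist v u' + G.dist u' w := by
            have := SimpleGraph.dist_le (b.append c)
            rwa [SimpleGraph.Walk.length_append, hb, hc] at this
          simp only [Set.mem_iUnion]
          exact ⟨u', hadj, ⟨q'.reachable, by omega⟩, hvu', by omega⟩
  have hD : (D v).Infinite := by
    refine hv.mono fun w hw => ⟨hw, ?_⟩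
    rw [SimpleGraph.dist_self, zero_add]
  choose next hnext using hstep
  let w : ℕ → T := fun n => next^[n] ⟨v, SimpleGraph.Reachable.refl v, hD⟩
  have hw : ∀ n, w (n + 1) = next (w n) := fun n => Function.iterate_succ_apply' _ _ _
  -- The growing distance from `v` rules out repetitions.
  have hdist : ∀ n, G.dist v (w n).1 = n := by
    intro n
    induction n with
    | zero => exact SimpleGraph.dist_self
    | succ n ih => rw [hw, (hnext _).2, ih]
  refine ⟨fun n => (w n).1, ⟨fun i => ?_, fun i j hij h => ?_⟩, rfl⟩
  · change G.Adj (w i).1 (w (i + 1)).1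
    rw [hw]
    exact (hnext _).1
  · have := congrArg (G.dist v) h
    simp only [hdist] at this
    omega

/-- The vertices that cannot escape to infinity without meeting `S`. -/
def enclosure (G : SimpleGraph V) (S : Set V) : Set V :=
  {v | ¬ ∃ w : ℕ → V, IsInfCycleFreePath G w ∧ (∃ i, w i = v) ∧ ∀ i, w i ∉ S}

/-- The graph `G` with the edges at vertices in `S` removed. -/
def avoid (G : SimpleGraph V) (S : Set V) : SimpleGraph V where
  Adj v w := G.Adj v w ∧ v ∉ S ∧ w ∉ S
  symm := ⟨fun _ _ h => ⟨h.1.symm, h.2.2, h.2.1⟩⟩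
  loopless := ⟨fun _ h => h.1.ne rfl⟩

/-- König's lemma in `avoid G S`: an infinite component would contain a path from `v` that never
meets `S`. -/
theorem finite_reachable_of_mem_enclosure (hfin : ∀ v, (G.neighborSet v).Finite) {S : Set V}
    {v : V} (hv : v ∈ enclosure G S) : {w | (avoid G S).Reachable v w}.Finite := by
  by_contra hinf
  obtain ⟨w, hw, hw0⟩ := exists_infinite_path (G := avoid G S)
    (fun v => (hfin v).subset fun u hu => hu.1) v hinf
  exact hv ⟨w, ⟨fun i => (hw.1 i).1, hw.2⟩, ⟨0, hw0⟩, fun i => (hw.1 i).2.1⟩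

theorem exists_reachable_adj {S : Set V} {v s : V} (p : G.Walk v s) (hs : s ∈ S) (hv : v ∉ S) :
    ∃ u, (avoid G S).Reachable v u ∧ ∃ s' ∈ S, G.Adj s' u := by
  induction p with
  | nil => exact absurd hs hv
  | @cons v v' s hadj p ih =>
    by_cases hv' : v' ∈ S
    · exact ⟨v, SimpleGraph.Reachable.refl v, v', hv', hadj.symm⟩
    · obtain ⟨u, hu, h⟩ := ih hs hv'
      have hadj' : (avoid G S).Adj v v' := ⟨hadj, hv, hv'⟩
      exact ⟨u, hadj'.reachable.trans hu, h⟩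

/-- An enclosed vertex outside `S` lies in a finite component of `avoid G S`, and by connectedness
this component contains one of the finitely many neighbours of `S`. If `S` is empty, a single
enclosed vertex makes the whole graph finite. -/
theorem finite_enclosure (hconn : G.Preconnected) (hfin : ∀ v, (G.neighborSet v).Finite)
    {S : Set V} (hS : S.Finite) : (enclosure G S).Finite := by
  rcases S.eq_empty_or_nonempty with rfl | ⟨s, hs⟩
  · rcases (enclosure G ∅).eq_empty_or_nonempty with h | ⟨v, hv⟩
    · rw [h]; exact Set.finite_empty
    · refine (finite_reachable_of_mem_enclosure hfin hv).subset fun w _ => ?_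
      have : avoid G ∅ = G := by ext; simp [avoid]
      change (avoid G ∅).Reachable v w
      rw [this]
      exact hconn v w
  · have hN : (⋃ s ∈ S, G.neighborSet s).Finite := hS.biUnion fun s _ => hfin s
    refine (hS.union (hN.biUnion (t := fun u => {w | (avoid G S).Reachable u w ∧
      {w | (avoid G S).Reachable u w}.Finite}) fun u _ => ?_)).subset fun v hv => ?_
    · by_cases h : {w | (avoid G S).Reachable u w}.Finite
      · exact h.subset fun w hw => hw.1
      · exact Set.finite_empty.subset fun w hw => h hw.2
    · by_cases hvS : v ∈ S
      · exact Or.inl hvS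
      · obtain ⟨p⟩ := hconn v s
        obtain ⟨u, hu, s', hs', hadj⟩ := exists_reachable_adj p hs hvS
        right
        simp only [Set.mem_iUnion]
        refine ⟨u, ⟨s', hs', hadj⟩, hu.symm, ?_⟩
        exact (finite_reachable_of_mem_enclosure hfin hv).subset fun w hw => hu.trans hw

/-- The vertices in `P` from which an infinite path leads away from `P`. -/
def exits (G : SimpleGraph V) (P : Set V) : Set V :=
  {s | s ∈ P ∧ ∃ v : ℕ → V, IsInfCycleFreePath G v ∧ v 0 = s ∧ ∀ i, v i ∈ P → v i = s}

/-- If `v ∉ S` is adjacent to a vertex that escapes, prefixing `v` to the escaping path, unless it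
is already on it, lets `v` escape too. Conversely, a vertex of `S` is enclosed trivially, while the
next vertex on its path escapes, because the path meets `P` only at its start. -/
theorem vertexBoundary_enclosure_exits (P : Set V) :
    vertexBoundary G (enclosure G (exits G P)) = exits G P := by
  ext v
  constructor
  · rintro ⟨hv, w, hw, hadj⟩
    obtain ⟨u, hu, ⟨i, rfl⟩, hS⟩ := not_not.1 hw
    by_contra hvS
    by_cases hmem : ∃ j, u j = v
    · exact hv ⟨u, hu, hmem, hS⟩
    · push Not at hmem
      have ht := hu.tail i
      refine hv ⟨fun n => Nat.casesOn n v fun k => u (i + k), ⟨?_, ?_⟩, ⟨0, rfl⟩, ?_⟩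
      · rintro (_ | k)
        · exact hadj
        · exact ht.1 k
      · rintro (_ | k) (_ | l) hkl
        · omega
        · exact (hmem _).symm
        · omega
        · exact ht.2 k l (by omega)
      · rintro (_ | k)
        · exact hvS
        · exact hS _
  · intro hv
    refine ⟨fun ⟨w, _, ⟨i, hi⟩, h⟩ => h i (hi ▸ hv), ?_⟩
    obtain ⟨-, w, hw, rfl, hP⟩ := hv
    refine ⟨w 1, fun h => h ⟨fun i => w (1 + i), hw.tail 1, ⟨0, rfl⟩, fun i hi => ?_⟩, hw.1 0⟩
    exact hw.2 0 (1 + i) (by omega) (hP _ hi.1).symm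

/-- A cycle-free path has a last vertex in the finite set `B`. It lies in `P` since the path leaves
`B` there, and the tail avoids `P ⊆ B`, so this vertex is an exit. -/
theorem subset_enclosure_exits {P B : Set V} (hB : B.Finite) (hPB : P ⊆ B)
    (hadj : ∀ v w, v ∈ B → w ∉ B → G.Adj v w → v ∈ P) : B ⊆ enclosure G (exits G P) := by
  rintro v hv ⟨w, hw, ⟨i, rfl⟩, hS⟩
  have hfin : {j | w j ∈ B}.Finite := hB.preimage hw.injective.injOn
  obtain ⟨j, hj, hmax⟩ := hfin.exists_maximal ⟨i, hv⟩
  have hlast : ∀ k, j < k → w k ∉ B := fun k hk hkB => absurd (hmax hkB hk.le) (not_le.2 hk)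
  refine hS j ⟨hadj _ _ hj (hlast (j + 1) (by omega)) (hw.1 j), fun k => w (j + k), hw.tail j, rfl,
    fun k hk => ?_⟩
  rcases Nat.eq_zero_or_pos k with rfl | hk0
  · rfl
  · exact absurd (hPB hk) (hlast _ (by omega))

end Graph

/-! ### Orbits -/

theorem finite_isUnivPole (f : RatFunc K) : {s : OnePoint K | IsUnivPole f s}.Finite := by
  classical
  refine ((f.denom.roots.toFinset.finite_toSet.image ((↑) : K → OnePoint K)).insert ∞).subset
    fun s hs => ?_
  induction s using OnePoint.rec with
  | infty => exact Set.mem_insert _ _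
  | coe a =>
    refine Set.mem_insert_of_mem _ ⟨a, ?_, rfl⟩
    rw [Finset.mem_coe, Multiset.mem_toFinset, Polynomial.mem_roots f.denom_ne_zero,
      ← Polynomial.rootMultiplicity_pos f.denom_ne_zero]
    have : (0 : ℤ) < f.denom.rootMultiplicity a - f.num.rootMultiplicity a := hs
    omega

theorem finite_fst_eq {p : Poly2 K} (hp : Irreducible p) (hpy : p.degreeOf 1 ≠ 0)
    (O : Set (curve p)) (c : OnePoint K) : {v : O | v.1.1.1 = c}.Finite := by
  have hfin := finite_curve_line hp 0 (fun j hj => by fin_cases j <;> simp_all) c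
  refine Set.Finite.of_finite_image (f := fun v : O => v.1.1.2) (hfin.subset ?_) ?_
  · rintro _ ⟨v, hv, rfl⟩
    have := mem_curve_iff.1 v.1.2
    change v.1.1.1 = c at hv
    rw [hv] at this
    refine Eq.trans ?_ this
    congr 1
    ext k
    fin_cases k <;> simp
  · intro v hv w hw h
    exact Subtype.ext (Subtype.ext (Prod.ext (Eq.trans hv (Eq.symm hw)) h))

theorem finite_snd_eq {p : Poly2 K} (hp : Irreducible p) (hpx : p.degreeOf 0 ≠ 0)
    (O : Set (curve p)) (c : OnePoint K) : {v : O | v.1.1.2 = c}.Finite := by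
  have hfin := finite_curve_line hp 1 (fun j hj => by fin_cases j <;> simp_all) c
  refine Set.Finite.of_finite_image (f := fun v : O => v.1.1.1) (hfin.subset ?_) ?_
  · rintro _ ⟨v, hv, rfl⟩
    have := mem_curve_iff.1 v.1.2
    change v.1.1.2 = c at hv
    rw [hv] at this
    refine Eq.trans ?_ this
    congr 1
    ext k
    fin_cases k <;> simp
  · intro v hv w hw h
    exact Subtype.ext (Subtype.ext (Prod.ext h (Eq.trans hv (Eq.symm hw))))

/-- A chain generating the equivalence is a walk, as its intermediate points stay in the orbit. -/
theorem orbitGraph_preconnected {p : Poly2 K} {O : Set (curve p)} (hO : IsOrbit O) :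
    (orbitGraph O).Preconnected := by
  obtain ⟨c, rfl⟩ := hO
  set O := {x | orbitSetoid p x c}
  have key : ∀ v w : curve p, Relation.EqvGen (fun v w => v.1.1 = w.1.1 ∨ v.1.2 = w.1.2) v w →
      ∀ (hv : v ∈ O) (hw : w ∈ O), (orbitGraph O).Reachable ⟨v, hv⟩ ⟨w, hw⟩ := by
    intro v w h
    induction h with
    | rel v w h =>
      intro hv hw
      by_cases hvw : v = w
      · subst hvw; exact SimpleGraph.Reachable.refl _
      · exact SimpleGraph.Adj.reachable (G := orbitGraph O) ⟨fun h => hvw (congrArg Subtype.val h), h⟩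
    | refl v => exact fun _ _ => SimpleGraph.Reachable.refl _
    | symm v w _ ih => exact fun hv hw => (ih hw hv).symm
    | trans u v w h1 _ ih1 ih2 =>
      intro hu hw
      have hv : v ∈ O := (Relation.EqvGen.symm _ _ h1).trans _ _ _ hu
      exact (ih1 hu hv).trans (ih2 hv hw)
  intro v w
  exact key v.1 w.1 (Relation.EqvGen.trans _ _ _ v.2 (Relation.EqvGen.symm _ _ w.2)) v.2 w.2

end SepVar

end

/-! ### The theorem on orbits -/

theorem mainTheorem9 {K : Type*} [Field K] [IsAlgClosed K] [CharZero K]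
    (p : MvPolynomial (Fin 2) K) (hp : Irreducible p)
    (hpx : p.degreeOf 0 ≠ 0) (hpy : p.degreeOf 1 ≠ 0)
    (r : FractionRing (MvPolynomial (Fin 2) K))
    (hr : r ∈ SepVar.localRing p) (hr' : r ∉ SepVar.localIdeal p)
    (f g : RatFunc K) (hfg : (f, g) ∈ SepVar.sepSet r p)
    (O : Set (SepVar.curve p)) (hO : SepVar.IsOrbit O) :
    (SepVar.enclosed O (SepVar.specialPoles r O)).Finite ∧
    (∀ v : O, SepVar.IsUnivPole f v.1.1.1 ∨ SepVar.IsUnivPole g v.1.1.2 →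
      v ∈ SepVar.enclosed O (SepVar.specialPoles r O)) ∧
    SepVar.vertexBoundary (SepVar.orbitGraph O)
      (SepVar.enclosed O (SepVar.specialPoles r O)) = SepVar.specialPoles r O := by
  open SepVar in
  let P : Set O := {v | IsPole r p v.1.1}
  let B : Set O := {v | IsUnivPole f v.1.1.1 ∨ IsUnivPole g v.1.1.2}
  have hB : B.Finite := by
    refine (((finite_isUnivPole f).biUnion fun c _ => finite_fst_eq hp hpy O c).union
      ((finite_isUnivPole g).biUnion fun c _ => finite_snd_eq hp hpx O c)).subset ?_
    rintro v (hv | hv)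
    · exact Or.inl (Set.mem_biUnion hv rfl)
    · exact Or.inr (Set.mem_biUnion hv rfl)
  have hPB : P ⊆ B := fun v hv => IsPole.isUnivPole_or hp hpx hfg hv
  have hadj : ∀ v w, v ∈ B → w ∉ B → (orbitGraph O).Adj v w → v ∈ P := by
    rintro v w hv hw ⟨-, h⟩
    obtain ⟨hw1, hw2⟩ := not_or.1 hw
    -- If `v` were no pole of `r`, both `f` and `g` would have poles at it, and the coordinate
    -- shared with `w` would put `w` in `B`.
    refine isPole_of_isUnivPole hp hpx hpy hfg v.1.2 fun hiff => ?_
    have hboth : IsUnivPole f v.1.1.1 ∧ IsUnivPole g v.1.1.2 :=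
      hv.elim (fun h1 => ⟨h1, hiff.1 h1⟩) (fun h2 => ⟨hiff.2 h2, h2⟩)
    rcases h with h | h
    · exact hw1 (h ▸ hboth.1)
    · exact hw2 (h ▸ hboth.2)
  have hfin : ∀ v, ((orbitGraph O).neighborSet v).Finite := fun v =>
    ((finite_fst_eq hp hpy O v.1.1.1).union (finite_snd_eq hp hpx O v.1.1.2)).subset
      fun w hw => hw.2.imp Eq.symm Eq.symm
  have hS : (exits (orbitGraph O) P).Finite := hB.subset fun v hv => hPB hv.1
  -- By definition, `specialPoles r O` is `exits` for `P`, and `enclosed` is `enclosure` in the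
  -- orbit graph.
  exact ⟨finite_enclosure (orbitGraph_preconnected hO) hfin hS,
    fun v hv => subset_enclosure_exits hB hPB hadj hv, vertexBoundary_enclosure_exits P⟩
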